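/- \textbf{Setting.} Let $O$ be a Hausdorff paracompact space. An \emph{integrable system} over $O$ is a smooth symplectic manifold $(M^{2n},\omega)$ with a proper surjective map $\pi:M\to O$ with connected fibres such that near each fibre there is a \emph{moment map}: $n$ smooth, Poisson-commuting, functionally independent functions on a set $\pi^{-1}(U)$, the connected components of whose common level sets are the fibres of $\pi$ over $U$. The \emph{rank} of $p\in M$ is the maximal dimension of the span of the differentials at $p$ of such a moment map; the \emph{stratum} of $p$ is the path component of $p$ in the set of points of the same fibre with the same rank. For open $U\subset O$: $\bullet$ $R(U)$ is the abelian group of symplectic $\mathbb S^1$-actions on $\pi^{-1}(U)$ preserving each fibre (the affine monodromy sheaf $\mathcal R$). It is regarded as a subgroup of the group $\Pi(U)$ of continuous families, indexed by $p\in\pi^{-1}(U)$, of homotopy classes of loops at $p$ in the stratum of $p$, an action being sent to the classes of its orbits. $\bullet$ $A_t(U)$ is the group of homeomorphisms of $\pi^{-1}(U)$ that preserve each stratum of each fibre and induce the identity on the fundamental group of each stratum and on $H_1(\cdot,\mathbb Z)$ of each fibre. $\bullet$ $\hat A_t(U)$ is the group of pairs $(f,h)$ with $f\in A_t(U)$ and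 $h$ a continuous family, indexed by $p$, of homotopy classes of paths from $p$ to $f(p)$ in the stratum of $p$; $\Pi(U)$ is its subgroup of pairs with $f=\mathrm{id}$. Here a family of homotopy classes is continuous if, along every curve in $\pi^{-1}(U)$, it is locally represented by continuous families of paths. All systems below are assumed to satisfy the standing condition that $0\to\mathcal R\to\hat{\mathcal A}_t\to\mathcal A_t\to 0$ is exact, in the following sense: $R(U)=\Pi(U)$ for all $U$, and every element of $A_t(U)$ lifts to $\hat{A}_t$ near each point of $U$. A \emph{rough topological equivalence} over $O$ from a (reference) system $\pi_a:M_a\to O$ to a system $\pi_b:M_b\to O$ consists of an open covering $(U_i)$ of $O$ and homeomorphisms $\Phi_i:\pi_a^{-1}(U_i)\to\pi_b^{-1}(U_i)$ with $\pi_b\circ\Phi_i=\pi_a$, preserving the rank of points (hence mapping strata to strata), such that $\Phi_i^{-1}\circ\Phi_j\in A_t(U_i\cap U_j)$ (for the system $a$). Pushing loops forward by the $\Phi_i$ identifies the affine monodromy sheaves of the two systems. The \emph{Chern class} of $M_b$ with respect to $M_a$ is the image in the \v{C}ech cohomology group $H^2(O,\mathcal R)$ of the class of the cocycle $(\Phi_i^{-1}\Phi_j)$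 under the coboundary map of the above sequence: after refining the covering one lifts the transition homeomorphisms $\phi_{ij}=\Phi_i^{-1}\Phi_j$ to $\psi_{ij}\in\hat A_t(U_{ij})$, and the class is that of the cocycle $\psi_{ij}\psi_{jk}\psi_{ik}^{-1}\in R(U_{ijk})$. \textbf{Statement.} Let $\pi_i:(M_i,\omega_i)\to O$, $i=1,2,3$, be three integrable systems over $O$ as above. Let rough topological equivalences $E_{12}$ from $M_2$ to $M_1$, $E_{23}$ from $M_3$ to $M_2$ and $E_{31}$ from $M_1$ to $M_3$ be given which are compatible, i.e. the local composites $M_1\to M_3\to M_2\to M_1$ belong to $A_t$ of the first system, so that the three systems have one common affine monodromy sheaf $\mathcal R$ (whose sections are the triples of corresponding sections of the three affine monodromy sheaves). Then the Chern class $\mu_C^{ij}\in H^2(O,\mathcal R)$ of $M_i$ with respect to $M_j$, determined by $E_{ij}$, exists and is unique for $(i,j)=(1,2),(2,3),(3,1)$, and $$\mu_C^{12}+\mu_C^{23}+\mu_C^{31}=0 .$$ -/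

import Mathlib

open scoped Manifold ContDiff
open TopologicalSpace CategoryTheory Opposite

noncomputable section

/-! ### Integrable systems -/

/-- The model vector space of a `2n`-dimensional manifold. -/
abbrev PhaseModel (n : ℕ) : Type := EuclideanSpace ℝ (Fin (2 * n))

/-- A two-form on a manifold, pulled back to the model vector space by the inverse of the chart
at `c`. -/
def chartForm {n : ℕ} {M : Type} [TopologicalSpace M] [ChartedSpace (PhaseModel n) M]
    (form : ∀ p : M, TangentSpace 𝓘(ℝ, PhaseModel n) p [⋀^Fin 2]→L[ℝ] ℝ) (c : M)
    (y : PhaseModel n) : PhaseModel n [⋀^Fin 2]→L[ℝ] ℝ :=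
  (form ((extChartAt 𝓘(ℝ, PhaseModel n) c).symm y)).compContinuousLinearMap
    (mfderiv 𝓘(ℝ, PhaseModel n) 𝓘(ℝ, PhaseModel n) (extChartAt 𝓘(ℝ, PhaseModel n) c).symm y)

/-- A proper fibration `π : M → O` with connected fibres of a symplectic manifold `(M, ω)` of
dimension `2n` over a topological space `O`, before any condition on moment maps. The two-form `form` is
smooth and closed when it is read in charts. -/
structure SymplecticFibration (O : Type) [TopologicalSpace O] where
  n : ℕ
  M : Type
  [topM : TopologicalSpace M]
  [t2M : T2Space M]
  [secondCountableM : SecondCountableTopology M]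
  [chartedM : ChartedSpace (PhaseModel n) M]
  [manifoldM : IsManifold 𝓘(ℝ, PhaseModel n) ∞ M]
  form : ∀ p : M, TangentSpace 𝓘(ℝ, PhaseModel n) p [⋀^Fin 2]→L[ℝ] ℝ
  form_smooth : ∀ c : M, ContDiffOn ℝ ∞ (chartForm form c)
    (extChartAt 𝓘(ℝ, PhaseModel n) c).target
  form_closed : ∀ c : M, ∀ y ∈ (extChartAt 𝓘(ℝ, PhaseModel n) c).target,
    extDeriv (chartForm form c) y = 0
  form_nondegenerate : ∀ (p : M) (v : TangentSpace 𝓘(ℝ, PhaseModel n) p),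
    (∀ w : TangentSpace 𝓘(ℝ, PhaseModel n) p, form p ![v, w] = 0) → v = 0
  π : M → O
  proper : IsProperMap π
  surjective : Function.Surjective π
  connected : ∀ x : O, IsConnected (π ⁻¹' {x})

attribute [instance] SymplecticFibration.topM SymplecticFibration.t2M
  SymplecticFibration.secondCountableM SymplecticFibration.chartedM SymplecticFibration.manifoldM

namespace SymplecticFibration

variable {O : Type} [TopologicalSpace O] (S : SymplecticFibration O)

/-- The model with corners of the phase space. -/
abbrev model : ModelWithCorners ℝ (PhaseModel S.n) (PhaseModel S.n) := 𝓘(ℝ, PhaseModel S.n)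

/-- The differential of the `i`-th component of `F` at `p`, as a covector. -/
def covector (F : S.M → Fin S.n → ℝ) (p : S.M) (i : Fin S.n) : TangentSpace S.model p →L[ℝ] ℝ :=
  mfderiv S.model 𝓘(ℝ, ℝ) (fun q => F q i) p

/-- `F = (F₁, …, Fₙ)` is a moment map of the system over the open set `U`: on `π⁻¹(U)` its
components are smooth, pairwise Poisson commuting (`ω(X_{F i}, X_{F j}) = 0`) and functionally
independent (their differentials are linearly independent on a dense subset), and the fibres of
`π` over `U` are the connected components of the level sets of `F` in `π⁻¹(U)`. -/
structure IsMomentMap (U : Opens O) (F : S.M → Fin S.n → ℝ) : Prop where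
  smooth : ∀ i, ContMDiffOn S.model 𝓘(ℝ, ℝ) ∞ (fun q => F q i) (S.π ⁻¹' U)
  commute : ∀ p, S.π p ∈ U → ∀ (i j : Fin S.n) (v w : TangentSpace S.model p),
    (∀ u, S.form p ![v, u] = S.covector F p i u) → (∀ u, S.form p ![w, u] = S.covector F p j u) →
    S.form p ![v, w] = 0
  independent : S.π ⁻¹' U ⊆ closure {p | S.π p ∈ U ∧ LinearIndependent ℝ (S.covector F p)}
  fibres : ∀ p, S.π p ∈ U →
    S.π ⁻¹' {S.π p} = connectedComponentIn (S.π ⁻¹' U ∩ F ⁻¹' {F p}) p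

/-- The rank of a point: the maximal dimension of the span of the differentials at `p` of the
components of a moment map defined near the fibre of `p`. -/
def rank (p : S.M) : ℕ :=
  sSup {d | ∃ (U : Opens O) (F : S.M → Fin S.n → ℝ), S.π p ∈ U ∧ S.IsMomentMap U F ∧
    d = Set.finrank ℝ (Set.range (S.covector F p))}

/-- The phase space as the topological disjoint union of its pieces of constant rank in one fibre:
the coarsest topology finer than the one of `M` in which `π` and the rank are locally constant.
A path, or a homotopy of paths, in `S.Leaf` is one in `M` that stays in one fibre and keeps the
rank constant. The path component of `p` in `S.Leaf` is the stratum of the fibre through `p`, and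
`FundamentalGroup S.Leaf p` is the fundamental group of this stratum. -/
structure Leaf where
  pt : S.M

/-- The point `p` of the phase space, in `S.Leaf`. -/
abbrev leaf (p : S.M) : S.Leaf := ⟨p⟩

instance : TopologicalSpace S.Leaf :=
  TopologicalSpace.induced (fun p : S.Leaf => p.pt) S.topM ⊓
    (TopologicalSpace.induced (fun p : S.Leaf => S.π p.pt) ⊥ ⊓
      TopologicalSpace.induced (fun p : S.Leaf => S.rank p.pt) ⊥)

/-- Paths from `p` to `q` in a stratum. -/
abbrev LeafPath (p q : S.M) : Type := Path (S.leaf p) (S.leaf q)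

/-- Homotopy classes, with fixed end points, of paths from `p` to `q` in a stratum. -/
abbrev PathClass (p q : S.M) : Type := Path.Homotopic.Quotient (S.leaf p) (S.leaf q)

/-- A choice, for every `p ∈ π⁻¹(U)`, of a homotopy class `h p` of paths from `p` to `f p` in the
stratum of `p`, is continuous if along every curve `ψ` in `π⁻¹(U)` it is, near each parameter
`t₀`, represented by a continuous family of paths. -/
def ContinuousClasses (U : Opens O) (f : S.M → S.M)
    (h : ∀ p : S.M, S.π p ∈ U → S.PathClass p (f p)) : Prop :=
  ∀ (ψ : C(unitInterval, S.M)) (hψ : ∀ t, S.π (ψ t) ∈ U) (t₀ : unitInterval),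
    ∃ N ∈ nhds t₀, ∃ G : ∀ t, S.LeafPath (ψ t) (f (ψ t)),
      (∀ t ∈ N, Path.Homotopic.Quotient.mk (G t) = h (ψ t) (hψ t)) ∧
      ContinuousOn (fun z : unitInterval × unitInterval => (G z.1 z.2).pt) (N ×ˢ Set.univ)

/-! ### The affine monodromy sheaf -/

/-- `α` is a smooth symplectic action of `𝕊¹ = ℝ/ℤ` on `π⁻¹(U)` that preserves every fibre. -/
structure IsCircleAction (U : Opens O) (α : ℝ → S.M → S.M) : Prop where
  smooth : ContMDiffOn (𝓘(ℝ, ℝ).prod S.model) S.model ∞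
    (fun z : ℝ × S.M => α z.1 z.2) (Set.univ ×ˢ (S.π ⁻¹' U))
  fibre : ∀ t p, S.π p ∈ U → S.π (α t p) = S.π p
  zero : ∀ p, S.π p ∈ U → α 0 p = p
  add : ∀ s t p, S.π p ∈ U → α (s + t) p = α s (α t p)
  one : ∀ p, S.π p ∈ U → α 1 p = p
  symplectic : ∀ t p, S.π p ∈ U → ∀ v w : TangentSpace S.model p,
    S.form (α t p) ![mfderiv S.model S.model (α t) p v, mfderiv S.model S.model (α t) p w] =
      S.form p ![v, w]

theorem IsCircleAction.mono {U V : Opens O} (h : V ≤ U) {α : ℝ → S.M → S.M}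
    (hα : S.IsCircleAction U α) : S.IsCircleAction V α where
  smooth := hα.smooth.mono (Set.prod_mono le_rfl (Set.preimage_mono h))
  fibre t p hp := hα.fibre t p (h hp)
  zero p hp := hα.zero p (h hp)
  add s t p hp := hα.add s t p (h hp)
  one p hp := hα.one p (h hp)
  symplectic t p hp := hα.symplectic t p (h hp)

/-- The class `c` of loops at `p` in its stratum is the class of the orbit of `p` under `α`. -/
def IsOrbitClass (α : ℝ → S.M → S.M) (p : S.M) (c : S.PathClass p p) : Prop :=
  ∃ o : S.LeafPath p p, (∀ t : unitInterval, (o t).pt = α t p) ∧ Path.Homotopic.Quotient.mk o = c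

instance (p : S.M) : CommGroup (Subgroup.center (FundamentalGroup S.Leaf (S.leaf p))) :=
  { (inferInstance : Group (Subgroup.center (FundamentalGroup S.Leaf (S.leaf p)))) with
    mul_comm := fun a b => Subtype.ext ((Subgroup.mem_center_iff.1 b.2 a.1)) }

/-- Families `(γ_p)` of central elements of the fundamental groups of the strata at the points
`p ∈ π⁻¹(U)`; an abelian group. (The class of an orbit of a circle action is central.) -/
abbrev LoopSection (U : Opens O) : Type :=
  ∀ p : {p : S.M // S.π p ∈ U}, Subgroup.center (FundamentalGroup S.Leaf (S.leaf p.1))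

/-- The group `R(U)` of system-preserving symplectic `𝕊¹`-actions on `π⁻¹(U)`. Such an action is
represented by the family of the homotopy classes of its orbits in the strata, which determines
it; the sum of actions (any two commute) becomes the product of classes, so that the families
that come from actions form a subgroup: the one they generate. -/
def R (U : Opens O) : Subgroup (S.LoopSection U) :=
  Subgroup.closure {γ | ∃ α, S.IsCircleAction U α ∧ ∀ p, S.IsOrbitClass α p.1 (γ p).1.toPath}

/-- Restriction of families of loop classes to a smaller open set. -/
def resLoop {U V : Opens O} (h : V ≤ U) : S.LoopSection U →* S.LoopSection V where
  toFun γ p := γ ⟨p.1, h p.2⟩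
  map_one' := rfl
  map_mul' _ _ := rfl

theorem resLoop_mem {U V : Opens O} (h : V ≤ U) {γ : S.LoopSection U} (hγ : γ ∈ S.R U) :
    S.resLoop h γ ∈ S.R V := by
  have : S.R U ≤ (S.R V).comap (S.resLoop h) := by
    refine (Subgroup.closure_le _).2 ?_
    rintro γ ⟨α, hα, ho⟩
    exact Subgroup.subset_closure ⟨α, hα.mono S h, fun p => ho ⟨p.1, h p.2⟩⟩
  exact this hγ

/-- The natural map from `R(U)` to the group `Π(U)` of all continuous families of homotopy classes
of loops in the strata is onto: every such family is given by the orbits of a system-preserving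
symplectic `𝕊¹`-action. -/
def CircleActionsExhaustLoops : Prop :=
  ∀ (U : Opens O) (γ : ∀ p : S.M, S.π p ∈ U → S.PathClass p p),
    S.ContinuousClasses U id γ →
      ∃ α, S.IsCircleAction U α ∧ ∀ p hp, S.IsOrbitClass α p (γ p hp)

/-! ### Admissible local homeomorphisms and their lifts -/

/-- `f` belongs to `A_t(U)`: it is a homeomorphism of `π⁻¹(U)` onto itself that preserves each
stratum of each fibre, induces the identity on the fundamental group of each stratum (`f ∘ γ` is
conjugate to `γ` by a path `δ` from `p` to `f p`, the same for all loops `γ` at `p`), and induces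
the identity on `H₁(-, ℤ)` of each fibre. -/
structure IsAdmissible (U : Opens O) (f : OpenPartialHomeomorph S.M S.M) : Prop where
  source_eq : f.source = S.π ⁻¹' U
  target_eq : f.target = S.π ⁻¹' U
  stratum : ∀ p : S.M, S.π p ∈ U → Joined (S.leaf p) (S.leaf (f p))
  fundamentalGroup : ∀ p : S.M, S.π p ∈ U → ∃ δ : S.LeafPath p (f p),
    ∀ (γ : S.LeafPath p p) (γ' : S.LeafPath (f p) (f p)), (∀ t, (γ' t).pt = f (γ t).pt) →
      (γ.trans δ).Homotopic (δ.trans γ')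
  homology : ∀ x ∈ U, ∀ g : C(S.π ⁻¹' {x}, S.π ⁻¹' {x}), (∀ p, (g p : S.M) = f p) →
    ((AlgebraicTopology.singularHomologyFunctor (ModuleCat.{0} ℤ) 1).obj
      (ModuleCat.of ℤ ℤ)).map (TopCat.ofHom g) = 𝟙 _

/-- An element over `f` of the extension `Â_t(U)` of `A_t(U)`: a continuous choice of a homotopy
class of paths from `p` to `f p` in the stratum of `p`. The product of `(f, h)` and `(f', h')` is
`f ∘ f'` with the classes `p ↦ h' p · h (f' p)`; the elements over the identity form `Π(U)`. An
isotopy from the identity to `f` inside `A_t(U)` gives such a lift, by the curves it traces. -/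
structure Lift (U : Opens O) (f : S.M → S.M) where
  cls : ∀ p : S.M, S.π p ∈ U → S.PathClass p (f p)
  continuous_cls : S.ContinuousClasses U f cls

/-- The sequence of sheaves `0 → R → Â_t → A_t → 0` is exact: the elements of `Â_t` over the
identity are exactly those given by symplectic circle actions, and every admissible homeomorphism
lifts locally over the base. -/
structure ExactSequence : Prop where
  exact : S.CircleActionsExhaustLoops
  lifts : ∀ (U : Opens O) (f : OpenPartialHomeomorph S.M S.M), S.IsAdmissible U f →
    ∀ x ∈ U, ∃ V : Opens O, x ∈ V ∧ V ≤ U ∧ Nonempty (S.Lift V f)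

end SymplecticFibration

/-- An integrable system over `O`: near each fibre it has a moment map. -/
structure IntegrableSystem (O : Type) [TopologicalSpace O] extends SymplecticFibration O where
  exists_momentMap : ∀ x : O, ∃ (U : Opens O) (F : M → Fin n → ℝ),
    x ∈ U ∧ toSymplecticFibration.IsMomentMap U F

/-! ### Čech cohomology in degree two -/

/-- An open covering of `O` indexed by the points of `O`, with `x ∈ V x`. These coverings are
cofinal among all open coverings. -/
structure PointedCover (O : Type) [TopologicalSpace O] where
  V : O → Opens O
  mem : ∀ x, x ∈ V x

namespace PointedCover

variable {O : Type} [TopologicalSpace O]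

/-- `𝒰 ≤ 𝒱` if `𝒱` refines `𝒰`. -/
instance : Preorder (PointedCover O) where
  le 𝒰 𝒱 := ∀ x, 𝒱.V x ≤ 𝒰.V x
  le_refl _ _ := le_rfl
  le_trans _ _ _ h h' x := (h' x).trans (h x)

end PointedCover

namespace Cech

variable {O : Type} [TopologicalSpace O] (F : (Opens O)ᵒᵖ ⥤ AddCommGrpCat.{0})

/-- Restriction of sections. -/
def res {U V : Opens O} (h : V ≤ U) : F.obj (op U) →+ F.obj (op V) := (F.map (homOfLE h).op).hom

theorem res_res {U V W : Opens O} (h : V ≤ U) (h' : W ≤ V) (s : F.obj (op U)) :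
    res F h' (res F h s) = res F (h'.trans h) s := by
  have : F.map (homOfLE (h'.trans h)).op = F.map (homOfLE h).op ≫ F.map (homOfLE h').op := by
    rw [← F.map_comp]; rfl
  simp only [res, this]
  rfl

variable (𝒱 : PointedCover O)

abbrev C1 : Type := ∀ x y : O, F.obj (op (𝒱.V x ⊓ 𝒱.V y))

abbrev C2 : Type := ∀ x y z : O, F.obj (op (𝒱.V x ⊓ 𝒱.V y ⊓ 𝒱.V z))

abbrev C3 : Type := ∀ x y z w : O, F.obj (op (𝒱.V x ⊓ 𝒱.V y ⊓ 𝒱.V z ⊓ 𝒱.V w))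

theorem le_yz (A B C : Opens O) : A ⊓ B ⊓ C ≤ B ⊓ C := inf_le_inf_right _ inf_le_right
theorem le_xz (A B C : Opens O) : A ⊓ B ⊓ C ≤ A ⊓ C := inf_le_inf_right _ inf_le_left
theorem le_xy (A B C : Opens O) : A ⊓ B ⊓ C ≤ A ⊓ B := inf_le_left
theorem le_yzw (A B C D : Opens O) : A ⊓ B ⊓ C ⊓ D ≤ B ⊓ C ⊓ D := inf_le_inf_right _ (le_yz A B C)
theorem le_xzw (A B C D : Opens O) : A ⊓ B ⊓ C ⊓ D ≤ A ⊓ C ⊓ D := inf_le_inf_right _ (le_xz A B C)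
theorem le_xyw (A B C D : Opens O) : A ⊓ B ⊓ C ⊓ D ≤ A ⊓ B ⊓ D := inf_le_inf_right _ (le_xy A B C)
theorem le_xyz (A B C D : Opens O) : A ⊓ B ⊓ C ⊓ D ≤ A ⊓ B ⊓ C := inf_le_left

/-- The Čech differential in degree one. -/
def d1 : C1 F 𝒱 →+ C2 F 𝒱 where
  toFun c x y z := res F (le_yz _ _ _) (c y z) - res F (le_xz _ _ _) (c x z)
    + res F (le_xy _ _ _) (c x y)
  map_zero' := by funext x y z; simp
  map_add' a b := by funext x y z; simp only [Pi.add_apply, map_add]; abel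

/-- The Čech differential in degree two. -/
def d2 : C2 F 𝒱 →+ C3 F 𝒱 where
  toFun c x y z w := res F (le_yzw _ _ _ _) (c y z w) - res F (le_xzw _ _ _ _) (c x z w)
    + res F (le_xyw _ _ _ _) (c x y w) - res F (le_xyz _ _ _ _) (c x y z)
  map_zero' := by funext x y z w; simp
  map_add' a b := by funext x y z w; simp only [Pi.add_apply, map_add]; abel

/-- Two-cocycles. -/
abbrev Z2 : AddSubgroup (C2 F 𝒱) := (d2 F 𝒱).ker

/-- `H²` of a covering: two-cocycles modulo coboundaries. -/
abbrev H2Cover : Type := Z2 F 𝒱 ⧸ ((d1 F 𝒱).range.addSubgroupOf (Z2 F 𝒱))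

variable {𝒱} {𝒲 : PointedCover O}

theorem inf3_le (h : 𝒱 ≤ 𝒲) (x y z : O) :
    𝒲.V x ⊓ 𝒲.V y ⊓ 𝒲.V z ≤ 𝒱.V x ⊓ 𝒱.V y ⊓ 𝒱.V z :=
  inf_le_inf (inf_le_inf (h x) (h y)) (h z)

/-- Restriction of two-cochains to a finer covering. -/
def resC2 (h : 𝒱 ≤ 𝒲) : C2 F 𝒱 →+ C2 F 𝒲 where
  toFun c x y z := res F (inf3_le h x y z) (c x y z)
  map_zero' := by funext x y z; simp
  map_add' a b := by funext x y z; simp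

theorem resC2_mem_Z2 (h : 𝒱 ≤ 𝒲) (c : C2 F 𝒱) (hc : c ∈ Z2 F 𝒱) : resC2 F h c ∈ Z2 F 𝒲 := by
  rw [AddMonoidHom.mem_ker] at hc ⊢
  funext x y z w
  have key := congrArg (res F (inf_le_inf (inf3_le h x y z) (h w)))
    (congrFun (congrFun (congrFun (congrFun hc x) y) z) w)
  simp only [d2, AddMonoidHom.coe_mk, ZeroHom.coe_mk, map_add, map_sub, res_res, Pi.zero_apply,
    map_zero] at key
  simpa only [d2, resC2, AddMonoidHom.coe_mk, ZeroHom.coe_mk, res_res, Pi.zero_apply] using key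

/-- Restriction of two-cocycles to a finer covering. -/
def resZ2 (h : 𝒱 ≤ 𝒲) : Z2 F 𝒱 →+ Z2 F 𝒲 :=
  ((resC2 F h).comp (Z2 F 𝒱).subtype).codRestrict (Z2 F 𝒲) fun c => resC2_mem_Z2 F h c.1 c.2

theorem resZ2_coboundary (h : 𝒱 ≤ 𝒲) :
    (d1 F 𝒱).range.addSubgroupOf (Z2 F 𝒱) ≤
      ((d1 F 𝒲).range.addSubgroupOf (Z2 F 𝒲)).comap (resZ2 F h) := by
  rintro c ⟨b, hb⟩
  refine ⟨fun x y => res F (inf_le_inf (h x) (h y)) (b x y), ?_⟩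
  funext x y z
  have key := congrArg (res F (inf3_le h x y z)) (congrFun (congrFun (congrFun hb x) y) z)
  simp only [d1, AddMonoidHom.coe_mk, ZeroHom.coe_mk, map_add, map_sub, res_res] at key
  simp only [d1, AddMonoidHom.coe_mk, ZeroHom.coe_mk, res_res]
  exact key

/-- Restriction of cohomology classes of a covering to a finer covering. -/
def resH2 (𝒱 𝒲 : PointedCover O) (h : 𝒱 ≤ 𝒲) : H2Cover F 𝒱 →+ H2Cover F 𝒲 :=
  QuotientAddGroup.map _ _ (resZ2 F h) (resZ2_coboundary F h)

open Classical in
/-- Čech cohomology `H²(O, F)`: the direct limit of `H²` over all coverings. -/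
def H2 : Type := AddCommGroup.DirectLimit (H2Cover F) (resH2 F)

open Classical in
instance : AddCommGroup (H2 F) := AddCommGroup.DirectLimit.addCommGroup (H2Cover F) (resH2 F)

open Classical in
/-- The cohomology class of a two-cocycle. -/
def H2.mk {𝒱 : PointedCover O} (r : Z2 F 𝒱) : H2 F :=
  AddCommGroup.DirectLimit.of (H2Cover F) (resH2 F) 𝒱 (QuotientAddGroup.mk r)

end Cech

/-! ### Rough topological equivalence -/

variable {O : Type} [TopologicalSpace O]

/-- A rough topological equivalence, over the identity of `O`, of the reference system `A` with
the system `B`: homeomorphisms `Φ i : π_A⁻¹(U i) → π_B⁻¹(U i)` over the members of an open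
covering, compatible with the projections and with the strata, such that
`(Φ i)⁻¹ ∘ Φ j` belongs to `A_t(U i ∩ U j)`. -/
structure RoughEquiv (A B : IntegrableSystem O) where
  ι : Type
  U : ι → Opens O
  cover : ∀ x, ∃ i, x ∈ U i
  Φ : ι → OpenPartialHomeomorph A.M B.M
  source_eq : ∀ i, (Φ i).source = A.π ⁻¹' (U i)
  target_eq : ∀ i, (Φ i).target = B.π ⁻¹' (U i)
  π_comp : ∀ i p, A.π p ∈ U i → B.π (Φ i p) = A.π p
  rank_comp : ∀ i p, A.π p ∈ U i → B.rank (Φ i p) = A.rank p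
  admissible : ∀ i j, A.IsAdmissible (U i ⊓ U j) ((Φ j).trans (Φ i).symm)

namespace RoughEquiv

variable {A B : IntegrableSystem O} (E : RoughEquiv A B)

/-- The transition homeomorphism `(Φ i)⁻¹ ∘ Φ j`. -/
def tr (i j : E.ι) : OpenPartialHomeomorph A.M A.M := (E.Φ j).trans (E.Φ i).symm

theorem tr_tr (i j k : E.ι) (p : A.M) (hj : A.π p ∈ E.U j) (hk : A.π p ∈ E.U k) :
    E.tr i j (E.tr j k p) = E.tr i k p := by
  have h : E.Φ k p ∈ (E.Φ j).target := by
    rw [E.target_eq, Set.mem_preimage, E.π_comp k p hk]; exact hj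
  simp [tr, (E.Φ j).right_inv h]

theorem π_tr (i j : E.ι) (p : A.M) (hi : A.π p ∈ E.U i) (hj : A.π p ∈ E.U j) :
    A.π (E.tr i j p) = A.π p := by
  have h : E.Φ j p ∈ (E.Φ i).target := by
    rw [E.target_eq, Set.mem_preimage, E.π_comp j p hj]; exact hi
  have h' : (E.Φ i).symm (E.Φ j p) ∈ (E.Φ i).source := (E.Φ i).map_target h
  rw [E.source_eq] at h'
  have := E.π_comp i _ h'
  rw [(E.Φ i).right_inv h, E.π_comp j p hj] at this
  exact this.symm

/-- The families `γ` and `γ'` of loop classes of `A` and `B` over `V` correspond to each other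
under the homeomorphisms `Φ i`. -/
def Corresponds (V : Opens O) (γ : A.LoopSection V) (γ' : B.LoopSection V) : Prop :=
  ∀ (i : E.ι) (p : A.M) (hp : A.π p ∈ V), A.π p ∈ E.U i → ∀ hp' : B.π (E.Φ i p) ∈ V,
    ∃ (l : A.LeafPath p p) (l' : B.LeafPath (E.Φ i p) (E.Φ i p)),
      (∀ t, (l' t).pt = E.Φ i (l t).pt) ∧
      Path.Homotopic.Quotient.mk l = (γ ⟨p, hp⟩).1.toPath ∧
      Path.Homotopic.Quotient.mk l' = (γ' ⟨E.Φ i p, hp'⟩).1.toPath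

/-- The subgroup of pairs of corresponding families. -/
def corr (V : Opens O) : Subgroup (A.LoopSection V × B.LoopSection V) where
  carrier := {g | E.Corresponds V g.1 g.2}
  one_mem' i p hp _ hp' := ⟨Path.refl _, Path.refl _, fun _ => rfl, rfl, rfl⟩
  mul_mem' {a b} ha hb i p hp hi hp' := by
    obtain ⟨l, l', hl, h1, h2⟩ := ha i p hp hi hp'
    obtain ⟨m, m', hm, h3, h4⟩ := hb i p hp hi hp'
    refine ⟨m.trans l, m'.trans l', fun t => ?_, ?_, ?_⟩
    · simp only [Path.trans_apply]; split_ifs <;> simp [hl, hm]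
    · rw [Path.Homotopic.Quotient.mk_trans, h1, h3]; rfl
    · rw [Path.Homotopic.Quotient.mk_trans, h2, h4]; rfl
  inv_mem' {a} ha i p hp hi hp' := by
    obtain ⟨l, l', hl, h1, h2⟩ := ha i p hp hi hp'
    refine ⟨l.symm, l'.symm, fun t => ?_, ?_, ?_⟩
    · simp [Path.symm_apply, hl]
    · rw [Path.Homotopic.Quotient.mk_symm, h1]; rfl
    · rw [Path.Homotopic.Quotient.mk_symm, h2]; rfl

/-- `c ∈ H²(O, F)` is the Chern class of `B` with respect to the reference system `A`, where the
sections of `F` are read as sections of the affine monodromy sheaf of `A` by `comp`: on some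
covering `𝒱` refining `(U i)` the transition homeomorphisms `φ_xy` lift to elements `ψ_xy` of
`Â_t`, the cocycle `r` is given by `ψ_xy ψ_yz = ψ_xz r_xyz`, and `c` is its class. This is the
image of the class of `(φ_xy)` under the coboundary map `H¹(O, A_t) → H²(O, R)`. -/
def IsChernClass {F : (Opens O)ᵒᵖ ⥤ AddCommGrpCat.{0}}
    (comp : ∀ V : Opens O, F.obj (op V) → A.LoopSection V) (c : Cech.H2 F) : Prop :=
  ∃ (𝒱 : PointedCover O) (τ : O → E.ι) (hτ : ∀ x, 𝒱.V x ≤ E.U (τ x))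
    (ψ : ∀ x y : O, A.Lift (𝒱.V x ⊓ 𝒱.V y) (E.tr (τ x) (τ y))) (r : Cech.Z2 F 𝒱),
    (∀ (x y z : O) (p : A.M) (hp : A.π p ∈ 𝒱.V x ⊓ 𝒱.V y ⊓ 𝒱.V z),
      ((ψ y z).cls p ⟨hp.1.2, hp.2⟩).trans
          ((ψ x y).cls (E.tr (τ y) (τ z) p)
            (by rw [E.π_tr _ _ p (hτ y hp.1.2) (hτ z hp.2)]; exact hp.1)) =
        ((comp _ (r.1 x y z) ⟨p, hp⟩).1.toPath.trans
          ((ψ x z).cls p ⟨hp.1.1, hp.2⟩)).cast rfl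
            (congrArg A.leaf (E.tr_tr _ _ _ p (hτ y hp.1.2) (hτ z hp.2)))) ∧
    c = Cech.H2.mk F r

end RoughEquiv

/-! ### Three roughly equivalent systems -/

section Three

variable {S₁ S₂ S₃ : IntegrableSystem O}
  (E₁₂ : RoughEquiv S₂ S₁) (E₂₃ : RoughEquiv S₃ S₂) (E₃₁ : RoughEquiv S₁ S₃)

/-- The three rough equivalences `S₁ → S₃ → S₂ → S₁` are compatible: their local composites
are admissible. -/
def RoughEquiv.Compatible : Prop :=
  ∀ (i : E₃₁.ι) (j : E₂₃.ι) (k : E₁₂.ι),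
    S₁.IsAdmissible (E₃₁.U i ⊓ E₂₃.U j ⊓ E₁₂.U k)
      (((E₃₁.Φ i).trans (E₂₃.Φ j)).trans (E₁₂.Φ k))

/-- Sections over `V` of the common affine monodromy sheaf of the three systems: triples of
sections of their affine monodromy sheaves that correspond to each other under the rough
equivalences. -/
def commonR (V : Opens O) :
    Subgroup (S₁.LoopSection V × S₂.LoopSection V × S₃.LoopSection V) :=
  ((S₁.R V).prod ((S₂.R V).prod (S₃.R V))) ⊓
    ((E₁₂.corr V).comap
        (((MonoidHom.fst _ _).comp (MonoidHom.snd _ _)).prod (MonoidHom.fst _ _)) ⊓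
      (E₂₃.corr V).comap
        (((MonoidHom.snd _ _).comp (MonoidHom.snd _ _)).prod
          ((MonoidHom.fst _ _).comp (MonoidHom.snd _ _))) ⊓
      (E₃₁.corr V).comap
        ((MonoidHom.fst _ _).prod ((MonoidHom.snd _ _).comp (MonoidHom.snd _ _))))

/-- Restriction of sections of the common affine monodromy sheaf. -/
def resCommon {U V : Opens O} (h : V ≤ U) :
    commonR E₁₂ E₂₃ E₃₁ U →* commonR E₁₂ E₂₃ E₃₁ V :=
  (((S₁.resLoop h).prodMap ((S₂.resLoop h).prodMap (S₃.resLoop h))).comp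
      (commonR E₁₂ E₂₃ E₃₁ U).subtype).codRestrict _ fun g => by
    obtain ⟨g, ⟨⟨h1, h2, h3⟩, ⟨c1, c2⟩, c3⟩⟩ := g
    exact ⟨⟨S₁.resLoop_mem h h1, S₂.resLoop_mem h h2, S₃.resLoop_mem h h3⟩,
      ⟨fun i p hp hi hp' => c1 i p (h hp) hi (h hp'),
        fun i p hp hi hp' => c2 i p (h hp) hi (h hp')⟩,
      fun i p hp hi hp' => c3 i p (h hp) hi (h hp')⟩

/-- The common affine monodromy sheaf `ℛ` of three roughly equivalent systems. -/
def commonSheaf : (Opens O)ᵒᵖ ⥤ AddCommGrpCat.{0} where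
  obj V := AddCommGrpCat.of (Additive (commonR E₁₂ E₂₃ E₃₁ V.unop))
  map f := AddCommGrpCat.ofHom (MonoidHom.toAdditive (resCommon E₁₂ E₂₃ E₃₁ f.unop.le))
  map_id _ := rfl
  map_comp _ _ := rfl

/-- The component of a section of `ℛ` in the affine monodromy sheaf of `S₁`. -/
def comp₁ (V : Opens O) (g : (commonSheaf E₁₂ E₂₃ E₃₁).obj (op V)) : S₁.LoopSection V :=
  (Additive.toMul (α := commonR E₁₂ E₂₃ E₃₁ V) g).1.1

/-- The component of a section of `ℛ` in the affine monodromy sheaf of `S₂`. -/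
def comp₂ (V : Opens O) (g : (commonSheaf E₁₂ E₂₃ E₃₁).obj (op V)) : S₂.LoopSection V :=
  (Additive.toMul (α := commonR E₁₂ E₂₃ E₃₁ V) g).1.2.1

/-- The component of a section of `ℛ` in the affine monodromy sheaf of `S₃`. -/
def comp₃ (V : Opens O) (g : (commonSheaf E₁₂ E₂₃ E₃₁).obj (op V)) : S₃.LoopSection V :=
  (Additive.toMul (α := commonR E₁₂ E₂₃ E₃₁ V) g).1.2.2

end Three

end

/-! A lift of the transition map `φ_xy = Φ_x⁻¹ Φ_y` to `Â_t`, pushed forward by `Φ_x`, is a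
continuous family `α_xy` of path classes from `Φ_x p` to `Φ_y p` in the strata of the target system:
a homotopy between two local identifications. The Chern cocycle measures how far these homotopies
are from coherent, `α_xy ⬝ α_yz = ρ_xyz ⬝ α_xz`, with `ρ_xyz` a continuous family of loop classes,
that is, a section of the affine monodromy sheaf (`RoughEquiv.isCocycle_liftCell`).

In this form Chern classes can be composed. If `f_x : A → B` carries homotopies with defect `ρ` and
`g_x : B → C` carries homotopies with defect `σ`, then `g_x ∘ f_x` carries composite homotopies
whose defect is the product of `σ` and the image of `ρ` (`IsCocycle.comp`). Around the triangle this
gives local maps `f_x : S₁ → S₁` whose defect represents the sum of the three classes. By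
compatibility the `f_x` are admissible, so by exactness each lifts near `x`: there is a continuous
family `a_x` of path classes from `p` to `f_x p`. The loop classes `a_x ⬝ α_xy ⬝ a_y⁻¹` form a
one-cochain whose coboundary is the defect (`IsCocycle.trivialize`), so the sum vanishes.

The sum formula holds for all choices of coverings and lifts. Hence, once each class exists, fixing
two of them and varying the third gives uniqueness by cancellation. Existence needs lifts on all
pairwise intersections of one covering, which paracompactness provides
(`PointedCover.exists_pairwise`).

Non-commutativity is controlled by one fact: a continuous family of path classes is natural along
paths in the strata (`IsCell.natural`). It makes continuous families of loop classes central, lets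
defects slide along path classes, and makes admissible maps preserve such families
(`IsAdmissible.cls_loop`). -/

open scoped unitInterval

local infixl:70 " ⬝ " => Path.Homotopic.Quotient.trans

/-! ### Path classes and their naturality along curves -/

namespace Path.Homotopic.Quotient

variable {X : Type*} [TopologicalSpace X]

theorem trans_left_cancel {x y z : X} {a : Path.Homotopic.Quotient x y}
    {b c : Path.Homotopic.Quotient y z} (h : a ⬝ b = a ⬝ c) : b = c := by
  have := congrArg (fun d => a.symm ⬝ d) h
  simpa only [← trans_assoc, symm_trans, refl_trans] using this

theorem trans_right_cancel {x y z : X} {a b : Path.Homotopic.Quotient x y}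
    {c : Path.Homotopic.Quotient y z} (h : a ⬝ c = b ⬝ c) : a = b := by
  have := congrArg (fun d => d ⬝ c.symm) h
  simpa only [trans_assoc, trans_symm, trans_refl] using this

theorem map_trans {Y : Type*} [TopologicalSpace Y] (f : C(X, Y)) {x y z : X}
    (a : Path.Homotopic.Quotient x y) (b : Path.Homotopic.Quotient y z) :
    (a ⬝ b).map f = a.map f ⬝ b.map f := by
  induction a using Quotient.ind with | mk a =>
  induction b using Quotient.ind with | mk b =>
  rw [← mk_trans, ← mk_map, ← mk_map, ← mk_map, ← mk_trans, Path.map_trans]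

theorem map_symm {Y : Type*} [TopologicalSpace Y] (f : C(X, Y)) {x y : X}
    (a : Path.Homotopic.Quotient x y) : a.symm.map f = (a.map f).symm := by
  induction a using Quotient.ind with | mk a =>
  rfl

theorem trans_cast {x y z z' : X} (a : Path.Homotopic.Quotient x y)
    (b : Path.Homotopic.Quotient y z) (h : z' = z) :
    (a ⬝ b).cast rfl h = a ⬝ b.cast rfl h := by
  subst h
  simp only [cast_rfl_rfl]

/-- The two ways around a continuous square are homotopic. -/
theorem mk_trans_eq_of_square {p q p' q' : X} {a : Path p q} {b : Path p' q'} {l : Path p p'}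
    {r : Path q q'} (H : C(I × I, X)) (ha : ∀ u, H (u, 0) = a u) (hb : ∀ u, H (u, 1) = b u)
    (hl : ∀ v, H (0, v) = l v) (hr : ∀ v, H (1, v) = r v) :
    mk a ⬝ mk r = mk l ⬝ mk b := by
  obtain rfl : H (0, 0) = p := by rw [ha]; simp
  obtain rfl : H (1, 0) = q := by rw [ha]; simp
  obtain rfl : H (0, 1) = p' := by rw [hb]; simp
  obtain rfl : H (1, 1) = q' := by rw [hb]; simp
  let A : Path ((0 : I), (0 : I)) (1, 0) := ⟨⟨fun u => (u, 0), by fun_prop⟩, rfl, rfl⟩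
  let B : Path ((0 : I), (1 : I)) (1, 1) := ⟨⟨fun u => (u, 1), by fun_prop⟩, rfl, rfl⟩
  let L : Path ((0 : I), (0 : I)) (0, 1) := ⟨⟨fun u => (0, u), by fun_prop⟩, rfl, rfl⟩
  let R : Path ((1 : I), (0 : I)) (1, 1) := ⟨⟨fun u => (1, u), by fun_prop⟩, rfl, rfl⟩
  have hA : a = A.map H.continuous := by ext u; exact (ha u).symm
  have hB : b = B.map H.continuous := by ext u; exact (hb u).symm
  have hL : l = L.map H.continuous := by ext u; exact (hl u).symm
  have hR : r = R.map H.continuous := by ext u; exact (hr u).symm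
  have : ContractibleSpace I :=
    (convex_Icc (0 : ℝ) 1).contractibleSpace ⟨0, by simp⟩
  -- Both sides are images under `H` of paths in the contractible square `I × I` with the same end
  -- points.
  rw [hA, hB, hL, hR, mk_map, mk_map, mk_map, mk_map, ← map_trans, ← map_trans]
  exact congrArg (fun d => map d H) (Subsingleton.elim _ _)

/-- A locally continuous family of path classes between two curves is natural along them. -/
theorem map_trans_eq_of_locallyContinuous (a b : C(I, X))
    (h : ∀ t, Path.Homotopic.Quotient (a t) (b t))
    (hh : ∀ t₀, ∃ N ∈ nhds t₀, ∃ G : ∀ t, Path (a t) (b t),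
      (∀ t ∈ N, mk (G t) = h t) ∧ ContinuousOn (fun z : I × I => G z.1 z.2) (N ×ˢ Set.univ))
    (s t : I) (u : Path.Homotopic.Quotient s t) : u.map a ⬝ h t = h s ⬝ u.map b := by
  have : ContractibleSpace I :=
    (convex_Icc (0 : ℝ) 1).contractibleSpace ⟨0, by simp⟩
  have : LocallyPathConnectedSpace I := (convex_Icc (0 : ℝ) 1).locallyPathConnectedSpace
  let P : I → I → Prop := fun s t => ∀ u : Path.Homotopic.Quotient s t,
    u.map a ⬝ h t = h s ⬝ u.map b
  have hsymm : Std.Symm P := by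
    constructor
    intro x y hxy u
    have := hxy u.symm
    rw [map_symm, map_symm] at this
    apply trans_left_cancel (a := (u.map a).symm)
    rw [← trans_assoc, symm_trans, refl_trans, ← trans_assoc, this, trans_assoc, symm_trans,
      trans_refl]
  -- The relation `P` is symmetric and transitive on the connected interval, so it is enough to
  -- prove it near each point, where one continuous family represents `h`.
  refine PreconnectedSpace.induction₂ (α := I) P ?_ ⟨?_⟩ s t u
  · intro t₀
    obtain ⟨N, hN, G, hG, hc⟩ := hh t₀
    -- Passing to the path component of `t₀` in `N` keeps a path from `t₀` to `y` inside `N`; the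
    -- representatives over it sweep out a continuous square.
    filter_upwards [pathComponentIn_mem_nhds hN] with y hy u
    obtain ⟨ρ, hp⟩ := hy
    rw [Subsingleton.elim u (mk ρ), ← hG _ (mem_of_mem_nhds hN), ← hG y (ρ.target ▸ hp 1)]
    refine mk_trans_eq_of_square
      ⟨fun z => G (ρ z.1) z.2, hc.comp_continuous (f := fun z : I × I => (ρ z.1, z.2))
        (by fun_prop) fun z => ⟨hp z.1, trivial⟩⟩ ?_ ?_ ?_ ?_
    · intro u; simp
    · intro u; simp
    · intro v; simp only [ContinuousMap.coe_mk]; rw [ρ.source]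
    · intro v; simp only [ContinuousMap.coe_mk]; rw [ρ.target]
  · intro x y z hxy hyz u
    let v : Path.Homotopic.Quotient x y := mk (PathConnectedSpace.somePath x y)
    let w : Path.Homotopic.Quotient y z := mk (PathConnectedSpace.somePath y z)
    rw [Subsingleton.elim u (v ⬝ w), map_trans, map_trans, trans_assoc, hyz, ← trans_assoc, hxy,
      trans_assoc]

end Path.Homotopic.Quotient

/-! ### Continuity in the leaf topology -/

noncomputable section
namespace SymplecticFibration

variable {O : Type} [TopologicalSpace O] {A B C S : SymplecticFibration O}

theorem Leaf.continuous_pt : Continuous (fun p : S.Leaf => p.pt) :=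
  continuous_iff_le_induced.2 inf_le_left

theorem Leaf.continuous_π : @Continuous S.Leaf _ _ ⊥ (fun p : S.Leaf => S.π p.pt) :=
  continuous_iff_le_induced.2 (inf_le_right.trans inf_le_left)

theorem Leaf.continuous_rank : @Continuous S.Leaf _ _ ⊥ (fun p : S.Leaf => S.rank p.pt) :=
  continuous_iff_le_induced.2 (inf_le_right.trans inf_le_right)

/-- A continuous map to the phase space that has the projection and the rank of a continuous map
to a leaf space is continuous as a map to the leaf space. -/
theorem Leaf.continuous_of_eq {X : Type*} [TopologicalSpace X] {g : X → A.Leaf}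
    (hg : Continuous g) {k : X → B.Leaf} (hk : Continuous fun x => (k x).pt)
    (hπ : ∀ x, B.π (k x).pt = A.π (g x).pt) (hr : ∀ x, B.rank (k x).pt = A.rank (g x).pt) :
    Continuous k := by
  refine continuous_inf_rng.2 ⟨continuous_induced_rng.2 hk,
    continuous_inf_rng.2 ⟨continuous_induced_rng.2 ?_, continuous_induced_rng.2 ?_⟩⟩
  · have : (fun p : B.Leaf => B.π p.pt) ∘ k = (fun p : A.Leaf => A.π p.pt) ∘ g := funext hπ
    rw [this]
    exact @Continuous.comp _ _ _ _ _ ⊥ _ _ Leaf.continuous_π hg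
  · have : (fun p : B.Leaf => B.rank p.pt) ∘ k = (fun p : A.Leaf => A.rank p.pt) ∘ g := funext hr
    rw [this]
    exact @Continuous.comp _ _ _ _ _ ⊥ _ _ Leaf.continuous_rank hg

theorem Leaf.π_eq_of_continuous {X : Type*} [TopologicalSpace X] [PreconnectedSpace X]
    {g : X → S.Leaf} (hg : Continuous g) (x y : X) : S.π (g x).pt = S.π (g y).pt :=
  IsLocallyConstant.apply_eq_of_preconnectedSpace (f := fun x => S.π (g x).pt)
    (fun s => (@Continuous.isOpen_preimage _ _ _ ⊥ _ Leaf.continuous_π s trivial).preimage hg) x y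

theorem Leaf.rank_eq_of_continuous {X : Type*} [TopologicalSpace X] [PreconnectedSpace X]
    {g : X → S.Leaf} (hg : Continuous g) (x y : X) : S.rank (g x).pt = S.rank (g y).pt :=
  IsLocallyConstant.apply_eq_of_preconnectedSpace (f := fun x => S.rank (g x).pt)
    (fun s => (@Continuous.isOpen_preimage _ _ _ ⊥ _ Leaf.continuous_rank s trivial).preimage hg)
    x y

theorem LeafPath.π_apply {p q : S.M} (l : S.LeafPath p q) (t : I) : S.π (l t).pt = S.π p := by
  have := Leaf.π_eq_of_continuous l.continuous t 0
  rwa [l.source] at this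

theorem LeafPath.rank_apply {p q : S.M} (l : S.LeafPath p q) (t : I) :
    S.rank (l t).pt = S.rank p := by
  have := Leaf.rank_eq_of_continuous l.continuous t 0
  rwa [l.source] at this

theorem LeafPath.π_eq {p q : S.M} (l : S.LeafPath p q) : S.π q = S.π p := by
  simpa using LeafPath.π_apply l 1

theorem LeafPath.rank_eq {p q : S.M} (l : S.LeafPath p q) : S.rank q = S.rank p := by
  simpa using LeafPath.rank_apply l 1

theorem PathClass.π_eq {p q : S.M} (c : S.PathClass p q) : S.π q = S.π p := by
  induction c using Path.Homotopic.Quotient.ind with | mk l => exact LeafPath.π_eq l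

/-! ### Families of path classes along a curve -/

/-- A family of path classes, indexed by the parameters of a curve, that is locally represented by
continuous families of paths. -/
def LocallyRepresented (S : SymplecticFibration O) (a b : I → S.M)
    (c : ∀ t, S.PathClass (a t) (b t)) : Prop :=
  ∀ t₀ : I, ∃ N ∈ nhds t₀, ∃ G : ∀ t, S.LeafPath (a t) (b t),
    (∀ t ∈ N, Path.Homotopic.Quotient.mk (G t) = c t) ∧
    ContinuousOn (fun z : I × I => (G z.1 z.2).pt) (N ×ˢ Set.univ)

/-- A path in a stratum, as a path in the phase space. -/
def LeafPath.toPath {p q : S.M} (l : S.LeafPath p q) : Path p q := l.map Leaf.continuous_pt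

/-- The curve of base points may cross strata, so joint continuity is only asked in the phase space,
not in `S.Leaf`. The right-hand side has the shape needed for `Path.trans_continuous_family`. -/
theorem continuousOn_family_iff {a b : I → S.M} (G : ∀ t, S.LeafPath (a t) (b t)) (N : Set I) :
    ContinuousOn (fun z : I × I => (G z.1 z.2).pt) (N ×ˢ Set.univ) ↔
      Continuous (fun z : N × I => LeafPath.toPath (G z.1) z.2) := by
  constructor
  · intro h
    exact h.comp_continuous (f := fun z : N × I => ((z.1 : I), z.2)) (by fun_prop)
      fun z => ⟨z.1.2, trivial⟩
  · intro h
    rw [continuousOn_iff_continuous_domRestrict]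
    exact h.comp (f := fun z : ↥(N ×ˢ (Set.univ : Set I)) => ((⟨z.1.1, z.2.1⟩, z.1.2) : N × I))
      (by fun_prop)

namespace LocallyRepresented

variable {a b c : I → S.M}

theorem trans {f : ∀ t, S.PathClass (a t) (b t)} {g : ∀ t, S.PathClass (b t) (c t)}
    (hf : S.LocallyRepresented a b f) (hg : S.LocallyRepresented b c g) :
    S.LocallyRepresented a c fun t => f t ⬝ g t := by
  intro t₀
  obtain ⟨N, hN, G, hG, hGc⟩ := hf t₀
  obtain ⟨N', hN', G', hG', hGc'⟩ := hg t₀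
  refine ⟨N ∩ N', Filter.inter_mem hN hN', fun t => (G t).trans (G' t), ?_, ?_⟩
  · intro t ht
    rw [Path.Homotopic.Quotient.mk_trans, hG t ht.1, hG' t ht.2]
  · refine (continuousOn_family_iff (fun t => (G t).trans (G' t)) (N ∩ N')).2 ?_
    have h1 := (continuousOn_family_iff G _).1
      (hGc.mono (Set.prod_mono_left (Set.inter_subset_left (t := N'))))
    have h2 := (continuousOn_family_iff G' _).1
      (hGc'.mono (Set.prod_mono_left (Set.inter_subset_right (s := N))))
    have h3 := Path.trans_continuous_family
      (fun t : ↥(N ∩ N') => LeafPath.toPath (G t)) h1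
      (fun t : ↥(N ∩ N') => LeafPath.toPath (G' t)) h2
    convert! h3 using 2 with z
    exact congrArg (fun l => l z.2) (Path.map_trans (G z.1) (G' z.1) Leaf.continuous_pt)

theorem symm {f : ∀ t, S.PathClass (a t) (b t)} (hf : S.LocallyRepresented a b f) :
    S.LocallyRepresented b a fun t => (f t).symm := by
  intro t₀
  obtain ⟨N, hN, G, hG, hGc⟩ := hf t₀
  refine ⟨N, hN, fun t => (G t).symm, ?_, ?_⟩
  · intro t ht
    rw [Path.Homotopic.Quotient.mk_symm, hG t ht]
  · exact hGc.comp (f := fun z : I × I => (z.1, unitInterval.symm z.2)) (by fun_prop)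
      fun z hz => ⟨hz.1, trivial⟩

theorem refl (ha : Continuous a) :
    S.LocallyRepresented a a fun t => Path.Homotopic.Quotient.refl (S.leaf (a t)) := fun _ =>
  ⟨Set.univ, Filter.univ_mem, fun _ => Path.refl _, fun _ _ => rfl,
    (ha.comp continuous_fst).continuousOn⟩

theorem cast {f : ∀ t, S.PathClass (a t) (b t)} (hf : S.LocallyRepresented a b f)
    {a' b' : I → S.M} (ha : ∀ t, a' t = a t) (hb : ∀ t, b' t = b t) :
    S.LocallyRepresented a' b' fun t =>
      (f t).cast (congrArg S.leaf (ha t)) (congrArg S.leaf (hb t)) := by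
  obtain rfl : a' = a := funext ha
  obtain rfl : b' = b := funext hb
  simpa only [Path.Homotopic.Quotient.cast_rfl_rfl] using hf

end LocallyRepresented

/-! ### Leaf maps -/

/-- `f` maps `π⁻¹(U)` continuously to another system over the same base, over the identity and
with preservation of the rank. -/
structure IsLeafMap (A B : SymplecticFibration O) (U : Opens O) (f : A.M → B.M) : Prop where
  continuousOn : ContinuousOn f (A.π ⁻¹' U)
  π_eq : ∀ p, A.π p ∈ U → B.π (f p) = A.π p
  rank_eq : ∀ p, A.π p ∈ U → B.rank (f p) = A.rank p

namespace IsLeafMap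

variable {U V : Opens O} {f : A.M → B.M} {g : B.M → C.M}

theorem mono (hf : IsLeafMap A B U f) (h : V ≤ U) : IsLeafMap A B V f where
  continuousOn := hf.continuousOn.mono (Set.preimage_mono h)
  π_eq p hp := hf.π_eq p (h hp)
  rank_eq p hp := hf.rank_eq p (h hp)

theorem mem (hf : IsLeafMap A B U f) {p : A.M} (hp : A.π p ∈ U) : B.π (f p) ∈ U := by
  rwa [hf.π_eq p hp]

theorem mem' (hf : IsLeafMap A B U f) {p : A.M} (hp : A.π p ∈ U) (hV : A.π p ∈ V) :
    B.π (f p) ∈ V := by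
  rwa [hf.π_eq p hp]

theorem comp (hg : IsLeafMap B C U g) (hf : IsLeafMap A B U f) :
    IsLeafMap A C U (fun p => g (f p)) where
  continuousOn := hg.continuousOn.comp hf.continuousOn fun _ hp => hf.mem hp
  π_eq p hp := by rw [hg.π_eq _ (hf.mem hp), hf.π_eq p hp]
  rank_eq p hp := by rw [hg.rank_eq _ (hf.mem hp), hf.rank_eq p hp]

theorem id (U : Opens O) : IsLeafMap A A U (fun p => p) where
  continuousOn := continuousOn_id
  π_eq _ _ := rfl
  rank_eq _ _ := rfl

theorem continuous_leaf (hf : IsLeafMap A B U f) {X : Type*} [TopologicalSpace X]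
    {k : X → A.Leaf} (hk : Continuous k) (hU : ∀ x, A.π (k x).pt ∈ U) :
    Continuous fun x => B.leaf (f (k x).pt) :=
  Leaf.continuous_of_eq hk
    (hf.continuousOn.comp_continuous (Leaf.continuous_pt.comp hk) hU)
    (fun x => hf.π_eq _ (hU x)) (fun x => hf.rank_eq _ (hU x))

/-- The image of a path in a stratum. -/
def path (hf : IsLeafMap A B U f) {p q : A.M} (hp : A.π p ∈ U) (l : A.LeafPath p q) :
    B.LeafPath (f p) (f q) where
  toFun t := B.leaf (f (l t).pt)
  continuous_toFun := hf.continuous_leaf l.continuous fun t => by rwa [LeafPath.π_apply l t]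
  source' := by simp
  target' := by simp

theorem path_homotopic (hf : IsLeafMap A B U f) {p q : A.M} (hp : A.π p ∈ U)
    {l l' : A.LeafPath p q} (h : l.Homotopic l') :
    (hf.path hp l).Homotopic (hf.path hp l') := by
  obtain ⟨H⟩ := h
  refine ⟨⟨⟨⟨fun z => B.leaf (f (H z).pt), hf.continuous_leaf H.continuous fun z => ?_⟩,
    fun t => ?_, fun t => ?_⟩, fun t x hx => ?_⟩⟩
  · rw [Leaf.π_eq_of_continuous H.continuous z (0, 0)]
    simpa using hp
  · simp [path]
  · simp [path]
  · have := H.prop' t x hx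
    exact congrArg (fun y : A.Leaf => B.leaf (f y.pt)) this

/-- The image of a path class. -/
def cls (hf : IsLeafMap A B U f) {p q : A.M} (hp : A.π p ∈ U) (c : A.PathClass p q) :
    B.PathClass (f p) (f q) :=
  _root_.Quotient.map (hf.path hp) (fun _ _ h => hf.path_homotopic hp h) c

theorem cls_mk (hf : IsLeafMap A B U f) {p q : A.M} (hp : A.π p ∈ U) (l : A.LeafPath p q) :
    hf.cls hp (Path.Homotopic.Quotient.mk l) = Path.Homotopic.Quotient.mk (hf.path hp l) := rfl

theorem cls_trans (hf : IsLeafMap A B U f) {p q r : A.M} (hp : A.π p ∈ U) (hq : A.π q ∈ U)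
    (c : A.PathClass p q) (d : A.PathClass q r) :
    hf.cls hp (c ⬝ d) = hf.cls hp c ⬝ hf.cls hq d := by
  induction c using Path.Homotopic.Quotient.ind with | mk l =>
  induction d using Path.Homotopic.Quotient.ind with | mk m =>
  rw [← Path.Homotopic.Quotient.mk_trans, cls_mk, cls_mk, cls_mk, ← Path.Homotopic.Quotient.mk_trans]
  congr 1
  ext t
  simp only [path, Path.trans_apply, Path.coe_mk_mk]
  split_ifs <;> rfl

theorem cls_cls (hg : IsLeafMap B C U g) (hf : IsLeafMap A B V f) {p q : A.M} (hp : A.π p ∈ V)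
    (hp' : B.π (f p) ∈ U) {W : Opens O} (hgf : IsLeafMap A C W fun p => g (f p))
    (hp'' : A.π p ∈ W) (c : A.PathClass p q) :
    hg.cls hp' (hf.cls hp c) = hgf.cls hp'' c := by
  induction c using Path.Homotopic.Quotient.ind with | mk l => rfl

theorem cls_id (h : IsLeafMap A A U (fun p => p)) {p q : A.M} (hp : A.π p ∈ U)
    (c : A.PathClass p q) : h.cls hp c = c := by
  induction c using Path.Homotopic.Quotient.ind with | mk l => rfl

theorem cls_cast (hf : IsLeafMap A B U f) {p q p' q' : A.M} (hp : A.π p ∈ U) (hp' : A.π p' ∈ U)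
    (h : p' = p) (h' : q' = q) (c : A.PathClass p q) :
    hf.cls hp' (c.cast (congrArg A.leaf h) (congrArg A.leaf h')) =
      (hf.cls hp c).cast (congrArg (fun x => B.leaf (f x)) h)
        (congrArg (fun x => B.leaf (f x)) h') := by
  subst h h'
  simp only [Path.Homotopic.Quotient.cast_rfl_rfl]

end IsLeafMap

theorem LocallyRepresented.map {U : Opens O} {f : A.M → B.M} (hf : IsLeafMap A B U f)
    {a b : I → A.M} {c : ∀ t, A.PathClass (a t) (b t)} (hc : A.LocallyRepresented a b c)
    (ha : ∀ t, A.π (a t) ∈ U) :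
    B.LocallyRepresented (fun t => f (a t)) (fun t => f (b t)) fun t => hf.cls (ha t) (c t) := by
  intro t₀
  obtain ⟨N, hN, G, hG, hGc⟩ := hc t₀
  refine ⟨N, hN, fun t => hf.path (ha t) (G t), ?_, ?_⟩
  · intro t ht
    exact congrArg (hf.cls (ha t)) (hG t ht)
  · exact hf.continuousOn.comp hGc fun z _ => by
      have := LeafPath.π_apply (G z.1) z.2
      rw [Set.mem_preimage, this]
      exact ha z.1

/-! ### Cells: continuous families of path classes between two leaf maps -/

/-- A family of path classes from `f p` to `g p`, indexed by `p ∈ π⁻¹(U)`, that is locally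
represented by continuous families of paths along every curve. -/
def IsCell (A B : SymplecticFibration O) (U : Opens O) (f g : A.M → B.M)
    (h : ∀ p : A.M, A.π p ∈ U → B.PathClass (f p) (g p)) : Prop :=
  ∀ (ψ : C(I, A.M)) (hψ : ∀ t, A.π (ψ t) ∈ U),
    B.LocallyRepresented (fun t => f (ψ t)) (fun t => g (ψ t)) fun t => h (ψ t) (hψ t)

theorem continuousClasses_iff {U : Opens O} {f : S.M → S.M}
    {h : ∀ p : S.M, S.π p ∈ U → S.PathClass p (f p)} :
    S.ContinuousClasses U f h ↔ IsCell S S U (fun p => p) f h := Iff.rfl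

namespace IsCell

variable {U V : Opens O} {f g k : A.M → B.M}
  {h : ∀ p : A.M, A.π p ∈ U → B.PathClass (f p) (g p)}

theorem mono (hh : IsCell A B U f g h) (hV : V ≤ U) :
    IsCell A B V f g fun p hp => h p (hV hp) :=
  fun ψ hψ => hh ψ fun t => hV (hψ t)

theorem trans {h' : ∀ p : A.M, A.π p ∈ U → B.PathClass (g p) (k p)}
    (hh : IsCell A B U f g h) (hh' : IsCell A B U g k h') :
    IsCell A B U f k fun p hp => h p hp ⬝ h' p hp :=
  fun ψ hψ => (hh ψ hψ).trans (hh' ψ hψ)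

theorem symm (hh : IsCell A B U f g h) : IsCell A B U g f fun p hp => (h p hp).symm :=
  fun ψ hψ => (hh ψ hψ).symm

theorem refl (hf : IsLeafMap A B U f) :
    IsCell A B U f f fun p _ => Path.Homotopic.Quotient.refl (B.leaf (f p)) :=
  fun ψ hψ => LocallyRepresented.refl (hf.continuousOn.comp_continuous ψ.continuous hψ)

theorem cast (hh : IsCell A B U f g h) {f' g' : A.M → B.M} (hf : ∀ p, A.π p ∈ U → f' p = f p)
    (hg : ∀ p, A.π p ∈ U → g' p = g p) :
    IsCell A B U f' g' fun p hp =>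
      (h p hp).cast (congrArg B.leaf (hf p hp)) (congrArg B.leaf (hg p hp)) :=
  fun ψ hψ => (hh ψ hψ).cast (fun t => hf _ (hψ t)) (fun t => hg _ (hψ t))

theorem map {m : B.M → C.M} (hm : IsLeafMap B C U m) (hf : IsLeafMap A B U f)
    (hh : IsCell A B U f g h) :
    IsCell A C U (fun p => m (f p)) (fun p => m (g p)) fun p hp => hm.cls (hf.mem hp) (h p hp) :=
  fun ψ hψ => (hh ψ hψ).map hm fun t => hf.mem (hψ t)

theorem comp {m : C.M → A.M} (hm : IsLeafMap C A U m) (hh : IsCell A B U f g h) :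
    IsCell C B U (fun p => f (m p)) (fun p => g (m p)) fun p hp => h (m p) (hm.mem hp) :=
  fun ψ hψ => hh ⟨fun t => m (ψ t), hm.continuousOn.comp_continuous ψ.continuous hψ⟩
    fun t => hm.mem (hψ t)

/-- A cell is natural along paths in the strata. -/
theorem natural (hh : IsCell A B U f g h) (hf : IsLeafMap A B V f) (hg : IsLeafMap A B V g)
    (hVU : V ≤ U) {p q : A.M} (hp : A.π p ∈ V) (hq : A.π q ∈ V) (c : A.PathClass p q) :
    hf.cls hp c ⬝ h q (hVU hq) = h p (hVU hp) ⬝ hg.cls hp c := by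
  induction c using Path.Homotopic.Quotient.ind with | mk l =>
  obtain ⟨L, h0, h1⟩ := l
  obtain rfl : (L 0).pt = p := congrArg Leaf.pt h0
  obtain rfl : (L 1).pt = q := congrArg Leaf.pt h1
  have hL : ∀ t, A.π (L t).pt ∈ V := fun t => by
    rw [Leaf.π_eq_of_continuous L.continuous t 0]; exact hp
  let a : C(I, B.Leaf) := ⟨fun t => B.leaf (f (L t).pt), hf.continuous_leaf L.continuous hL⟩
  let b : C(I, B.Leaf) := ⟨fun t => B.leaf (g (L t).pt), hg.continuous_leaf L.continuous hL⟩
  -- The given path is the image of the tautological path from `0` to `1` in the interval.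
  refine Path.Homotopic.Quotient.map_trans_eq_of_locallyContinuous a b
    (fun t => h (L t).pt (hVU (hL t))) ?_ 0 1 (Path.Homotopic.Quotient.mk ⟨ContinuousMap.id I, rfl, rfl⟩)
  intro t₀
  obtain ⟨N, hN, G, hG, hGc⟩ := hh ⟨fun t => (L t).pt, Leaf.continuous_pt.comp L.continuous⟩
    (fun t => hVU (hL t)) t₀
  refine ⟨N, hN, G, hG, ?_⟩
  rw [continuousOn_iff_continuous_domRestrict] at hGc ⊢
  -- Here the curve of base points stays in one stratum, so projection and rank are those of the
  -- curve `a`, and continuity in the phase space upgrades to continuity in the leaf space.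
  exact Leaf.continuous_of_eq
    (g := fun z : ↥(N ×ˢ (Set.univ : Set I)) => a z.1.1) (by fun_prop) hGc
    (fun z => LeafPath.π_apply (G z.1.1) z.1.2) (fun z => LeafPath.rank_apply (G z.1.1) z.1.2)

end IsCell
end SymplecticFibration
end

/-! ### Maps induced on path classes -/

noncomputable section
namespace SymplecticFibration

variable {O : Type} [TopologicalSpace O] {A B C S : SymplecticFibration O}

theorem IsLeafMap.cls_congr {U V : Opens O} {f g : A.M → B.M} (hf : IsLeafMap A B U f)
    (hg : IsLeafMap A B V g) {p q : A.M} (hp : A.π p ∈ U) (hp' : A.π p ∈ V) {W : Opens O}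
    (hW : A.π p ∈ W) (h : ∀ x, A.π x ∈ W → f x = g x) (c : A.PathClass p q) :
    hf.cls hp c = (hg.cls hp' c).cast (congrArg B.leaf (h p hW))
      (congrArg B.leaf (h q (by rwa [PathClass.π_eq c]))) := by
  induction c using Path.Homotopic.Quotient.ind with | mk l =>
  rw [cls_mk, cls_mk, ← Path.Homotopic.Quotient.mk_cast]
  congr 1
  ext t
  exact congrArg B.leaf (h _ (by rwa [LeafPath.π_apply l t]))

theorem IsLeafMap.cls_injective {U V : Opens O} {f : A.M → B.M} (hf : IsLeafMap A B U f)
    {g : B.M → A.M} (hg : IsLeafMap B A V g) (hgf : ∀ p, A.π p ∈ V → g (f p) = p) {p q : A.M}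
    (hp : A.π p ∈ U) (hp' : A.π p ∈ V) : Function.Injective (hf.cls (q := q) hp) := by
  intro c d h
  have h' := congrArg (hg.cls (hf.mem' hp hp')) h
  have hgf' : IsLeafMap A A (U ⊓ V) (fun p => g (f p)) :=
    (hg.mono inf_le_right).comp (hf.mono inf_le_left)
  rw [hg.cls_cls hf hp _ hgf' ⟨hp, hp'⟩, hg.cls_cls hf hp _ hgf' ⟨hp, hp'⟩,
    hgf'.cls_congr (IsLeafMap.id V) ⟨hp, hp'⟩ hp' hp' hgf,
    hgf'.cls_congr (IsLeafMap.id V) ⟨hp, hp'⟩ hp' hp' hgf, IsLeafMap.cls_id,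
    IsLeafMap.cls_id] at h'
  have h'' := congrArg (fun e => Path.Homotopic.Quotient.cast e
    (congrArg A.leaf (hgf p hp').symm)
    (congrArg A.leaf (hgf q (by rwa [PathClass.π_eq c])).symm)) h'
  simpa using h''

/-! ### Continuous families of loop classes -/

/-- A continuous family of classes of loops in the strata. -/
abbrev IsLoopCell (S : SymplecticFibration O) (U : Opens O)
    (γ : ∀ p : S.M, S.π p ∈ U → S.PathClass p p) : Prop :=
  IsCell S S U (fun p => p) (fun p => p) γ

/-- For `p = q` this is centrality in the fundamental group of the stratum; for `p ≠ q` it moves a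
loop family from one end of a path class to the other. -/
theorem IsLoopCell.natural {U : Opens O} {γ : ∀ p : S.M, S.π p ∈ U → S.PathClass p p}
    (h : S.IsLoopCell U γ) {p q : S.M} (hp : S.π p ∈ U) (hq : S.π q ∈ U) (c : S.PathClass p q) :
    c ⬝ γ q hq = γ p hp ⬝ c := by
  have := IsCell.natural h (IsLeafMap.id U) (IsLeafMap.id U) le_rfl hp hq c
  rwa [IsLeafMap.cls_id] at this

theorem IsAdmissible.isLeafMap {U : Opens O} {f : OpenPartialHomeomorph S.M S.M}
    (hf : S.IsAdmissible U f) : IsLeafMap S S U f where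
  continuousOn := hf.source_eq ▸ f.continuousOn
  π_eq p hp := LeafPath.π_eq (hf.stratum p hp).some
  rank_eq p hp := LeafPath.rank_eq (hf.stratum p hp).some

/-- Admissible homeomorphisms preserve continuous families of loop classes. -/
theorem IsAdmissible.cls_loop {U V : Opens O} {f : OpenPartialHomeomorph S.M S.M}
    (hf : S.IsAdmissible U f) {γ : ∀ p : S.M, S.π p ∈ V → S.PathClass p p}
    (h : S.IsLoopCell V γ) {p : S.M} (hp : S.π p ∈ U) (hV : S.π p ∈ V) (hV' : S.π (f p) ∈ V) :
    hf.isLeafMap.cls hp (γ p hV) = γ (f p) hV' := by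
  obtain ⟨δ, hδ⟩ := hf.fundamentalGroup p hp
  obtain ⟨l, hl⟩ := Path.Homotopic.Quotient.mk_surjective (γ p hV)
  -- Admissibility gives `γ_p ⬝ δ = δ ⬝ f(γ_p)` and naturality gives `δ ⬝ γ_{f p} = γ_p ⬝ δ`;
  -- cancelling `δ` finishes.
  have h1 := Path.Homotopic.Quotient.eq.2 (hδ l (hf.isLeafMap.path hp l) fun t => rfl)
  rw [Path.Homotopic.Quotient.mk_trans, Path.Homotopic.Quotient.mk_trans, hl,
    ← IsLeafMap.cls_mk, hl, ← h.natural hV hV'] at h1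
  exact (Path.Homotopic.Quotient.trans_left_cancel h1).symm

/-- The orbits themselves are a continuous family of representatives along the whole curve. -/
theorem IsCircleAction.isLoopCell {U : Opens O} {α : ℝ → S.M → S.M} (hα : S.IsCircleAction U α)
    {γ : ∀ p : S.M, S.π p ∈ U → S.PathClass p p} (h : ∀ p hp, S.IsOrbitClass α p (γ p hp)) :
    S.IsLoopCell U γ := by
  intro ψ hψ t₀
  choose o ho ho' using h
  refine ⟨Set.univ, Filter.univ_mem, fun t => o (ψ t) (hψ t), fun t _ => ho' _ _, ?_⟩
  simp only [ho]
  refine hα.smooth.continuousOn.comp (f := fun z : I × I => ((z.2 : ℝ), ψ z.1))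
    (by fun_prop) fun z _ => ⟨trivial, hψ z.1⟩

/-- The loop classes of a section, as a family indexed by points. -/
def LoopSection.cls {U : Opens O} (γ : S.LoopSection U) (p : S.M) (hp : S.π p ∈ U) :
    S.PathClass p p := (γ ⟨p, hp⟩).1.toPath

theorem LoopSection.ext_cls {U : Opens O} {γ γ' : S.LoopSection U}
    (h : ∀ p hp, LoopSection.cls γ p hp = LoopSection.cls γ' p hp) : γ = γ' := by
  funext p
  exact Subtype.ext (h p.1 p.2)

theorem LoopSection.cls_mul {U : Opens O} (γ γ' : S.LoopSection U) (p : S.M) (hp : S.π p ∈ U) :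
    LoopSection.cls (γ * γ') p hp = LoopSection.cls γ p hp ⬝ LoopSection.cls γ' p hp := by
  -- Multiplication in the fundamental group concatenates in the opposite order; centrality absorbs
  -- the difference.
  rw [mul_comm]
  rfl

/-- A continuous family of loop classes, as a section. -/
def IsLoopCell.toSection {U : Opens O} {γ : ∀ p : S.M, S.π p ∈ U → S.PathClass p p}
    (h : S.IsLoopCell U γ) : S.LoopSection U := fun p =>
  ⟨FundamentalGroup.fromPath (γ p.1 p.2), Subgroup.mem_center_iff.2 fun l =>
    (h.natural p.2 p.2 l.toPath).symm⟩

theorem IsLoopCell.cls_toSection {U : Opens O} {γ : ∀ p : S.M, S.π p ∈ U → S.PathClass p p}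
    (h : S.IsLoopCell U γ) (p : S.M) (hp : S.π p ∈ U) :
    LoopSection.cls h.toSection p hp = γ p hp := rfl

/-- The inclusion of `R(U)` in `Π(U)`, which needs no exactness. With the reverse inclusion below,
sections of the monodromy sheaf can be handled purely as continuous loop families. -/
theorem isLoopCell_of_mem_R {U : Opens O} {γ : S.LoopSection U} (hγ : γ ∈ S.R U) :
    S.IsLoopCell U (LoopSection.cls γ) := by
  induction hγ using Subgroup.closure_induction with
  | mem γ h =>
    obtain ⟨α, hα, ho⟩ := h
    exact hα.isLoopCell fun p hp => ho ⟨p, hp⟩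
  | one => exact IsCell.refl (IsLeafMap.id U)
  | mul γ γ' _ _ h h' => exact IsCell.trans h' h
  | inv γ _ h => exact IsCell.symm h

theorem CircleActionsExhaustLoops.toSection_mem_R (hS : S.CircleActionsExhaustLoops) {U : Opens O}
    {γ : ∀ p : S.M, S.π p ∈ U → S.PathClass p p} (h : S.IsLoopCell U γ) : h.toSection ∈ S.R U := by
  obtain ⟨α, hα, ho⟩ := hS U γ h
  exact Subgroup.subset_closure ⟨α, hα, fun p => ho p.1 p.2⟩

end SymplecticFibration

open SymplecticFibration

/-! ### Transport of loop classes by a rough equivalence -/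

namespace RoughEquiv

variable {O : Type} [TopologicalSpace O] {A B : IntegrableSystem O} (E : RoughEquiv A B)

theorem isLeafMap (i : E.ι) :
    IsLeafMap A.toSymplecticFibration B.toSymplecticFibration (E.U i) (E.Φ i) where
  continuousOn := E.source_eq i ▸ (E.Φ i).continuousOn
  π_eq p hp := E.π_comp i p hp
  rank_eq p hp := E.rank_comp i p hp

theorem symm_apply_apply (i : E.ι) (p : A.M) (hp : A.π p ∈ E.U i) :
    (E.Φ i).symm (E.Φ i p) = p :=
  (E.Φ i).left_inv (by rw [E.source_eq]; exact hp)

theorem apply_symm_apply (i : E.ι) (q : B.M) (hq : B.π q ∈ E.U i) :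
    E.Φ i ((E.Φ i).symm q) = q :=
  (E.Φ i).right_inv (by rw [E.target_eq]; exact hq)

theorem π_symm_mem (i : E.ι) (q : B.M) (hq : B.π q ∈ E.U i) :
    A.π ((E.Φ i).symm q) ∈ E.U i := by
  have : (E.Φ i).symm q ∈ (E.Φ i).source := (E.Φ i).map_target (by rw [E.target_eq]; exact hq)
  rwa [E.source_eq] at this

theorem isLeafMap_symm (i : E.ι) :
    IsLeafMap B.toSymplecticFibration A.toSymplecticFibration (E.U i) (E.Φ i).symm where
  continuousOn := E.target_eq i ▸ (E.Φ i).continuousOn_symm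
  π_eq q hq := by
    rw [← E.π_comp i _ (E.π_symm_mem i q hq), E.apply_symm_apply i q hq]
  rank_eq q hq := by
    rw [← E.rank_comp i _ (E.π_symm_mem i q hq), E.apply_symm_apply i q hq]

theorem isLeafMap_tr (i j : E.ι) :
    IsLeafMap A.toSymplecticFibration A.toSymplecticFibration (E.U i ⊓ E.U j) (E.tr i j) :=
  (E.admissible i j).isLeafMap

theorem apply_tr (i j : E.ι) (p : A.M) (hi : A.π p ∈ E.U i) (hj : A.π p ∈ E.U j) :
    E.Φ i (E.tr i j p) = E.Φ j p :=
  E.apply_symm_apply i _ ((E.isLeafMap j).mem' hj hi)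

theorem cls_injective (i : E.ι) {p q : A.M} (hp : A.π p ∈ E.U i) :
    Function.Injective ((E.isLeafMap i).cls (q := q) hp) :=
  (E.isLeafMap i).cls_injective (E.isLeafMap_symm i) (E.symm_apply_apply i) hp hp

theorem corresponds_iff {V : Opens O} {γ : A.LoopSection V} {γ' : B.LoopSection V} :
    E.Corresponds V γ γ' ↔ ∀ (i : E.ι) (p : A.M) (hp : A.π p ∈ V) (hi : A.π p ∈ E.U i),
      (E.isLeafMap i).cls hi (LoopSection.cls γ p hp) =
        LoopSection.cls γ' (E.Φ i p) ((E.isLeafMap i).mem' hi hp) := by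
  constructor
  · intro h i p hp hi
    obtain ⟨l, l', hl, h1, h2⟩ := h i p hp hi ((E.isLeafMap i).mem' hi hp)
    rw [LoopSection.cls, LoopSection.cls, ← h1, ← h2, IsLeafMap.cls_mk]
    congr 1
    ext t
    exact congrArg B.leaf (hl t).symm
  · intro h i p hp hi hp'
    obtain ⟨l, hl⟩ := Path.Homotopic.Quotient.mk_surjective (LoopSection.cls γ p hp)
    refine ⟨l, (E.isLeafMap i).path hi l, fun _ => rfl, hl, ?_⟩
    rw [← IsLeafMap.cls_mk, hl]
    exact h i p hp hi

theorem Corresponds.left_injective {E : RoughEquiv A B} {V : Opens O} {γ γ' : A.LoopSection V}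
    {δ : B.LoopSection V} (h : E.Corresponds V γ δ) (h' : E.Corresponds V γ' δ) : γ = γ' := by
  refine LoopSection.ext_cls fun p hp => ?_
  obtain ⟨i, hi⟩ := E.cover (A.π p)
  apply E.cls_injective i hi
  rw [E.corresponds_iff.1 h i p hp hi, E.corresponds_iff.1 h' i p hp hi]

theorem Corresponds.right_injective {E : RoughEquiv A B} {V : Opens O} {γ : A.LoopSection V}
    {δ δ' : B.LoopSection V} (h : E.Corresponds V γ δ) (h' : E.Corresponds V γ δ') : δ = δ' := by
  refine LoopSection.ext_cls fun q hq => ?_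
  obtain ⟨i, hi⟩ := E.cover (B.π q)
  obtain ⟨p, hp, rfl⟩ : ∃ p, A.π p ∈ E.U i ∧ E.Φ i p = q :=
    ⟨_, E.π_symm_mem i q hi, E.apply_symm_apply i q hi⟩
  have hpV : A.π p ∈ V := by rwa [E.π_comp i p hp] at hq
  rw [← E.corresponds_iff.1 h i p hpV hp, ← E.corresponds_iff.1 h' i p hpV hp]

/-- Over a member of the covering, continuous families of loop classes are pushed forward. -/
theorem exists_corresponds {V : Opens O} (i : E.ι) (hV : V ≤ E.U i) {γ : A.LoopSection V}
    (hγ : A.IsLoopCell V (LoopSection.cls γ)) :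
    ∃ γ' : B.LoopSection V, B.IsLoopCell V (LoopSection.cls γ') ∧ E.Corresponds V γ γ' := by
  have hs := (E.isLeafMap_symm i).mono hV
  have hΦ := (E.isLeafMap i).mono hV
  -- The pushed family is `q ↦ Φ_i(γ(Φ_i⁻¹ q))`.
  have hc : B.IsLoopCell V _ := ((hγ.comp hs).map hΦ hs).cast
    (fun q hq => (E.apply_symm_apply i q (hV hq)).symm)
    (fun q hq => (E.apply_symm_apply i q (hV hq)).symm)
  refine ⟨hc.toSection, hc, E.corresponds_iff.2 fun j p hp hj => ?_⟩
  have htr : (E.Φ i).symm (E.Φ j p) = E.tr i j p := rfl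
  rw [IsLoopCell.cls_toSection]
  have htrm := (E.isLeafMap_tr i j).mem' (V := V) ⟨hV hp, hj⟩ hp
  -- Independence of the chart: `Φ_j = Φ_i ∘ tr_ij`, and the admissible map `tr_ij` preserves the
  -- family `γ`.
  have key := (E.admissible i j).cls_loop hγ ⟨hV hp, hj⟩ hp htrm
  have hcomp : IsLeafMap A.toSymplecticFibration B.toSymplecticFibration (V ⊓ E.U j)
      (fun p => E.Φ i (E.tr i j p)) :=
    (hΦ.mono inf_le_left).comp ((E.isLeafMap_tr i j).mono (inf_le_inf_right _ hV))
  have key2 : hΦ.cls htrm (LoopSection.cls γ (E.tr i j p) htrm) =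
      ((E.isLeafMap j).cls hj (LoopSection.cls γ p hp)).cast
        (congrArg B.leaf (E.apply_tr i j p (hV hp) hj))
        (congrArg B.leaf (E.apply_tr i j p (hV hp) hj)) := by
    refine (congrArg (hΦ.cls htrm) key.symm).trans ?_
    refine (hΦ.cls_cls (E.isLeafMap_tr i j) ⟨hV hp, hj⟩ htrm hcomp ⟨hp, hj⟩ _).trans ?_
    exact hcomp.cls_congr (E.isLeafMap j) ⟨hp, hj⟩ hj (W := V ⊓ E.U j) ⟨hp, hj⟩
      (fun x hx => E.apply_tr i j x (hV hx.1) hx.2) _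
  have key3 := congrArg (fun e => Path.Homotopic.Quotient.cast e
    (congrArg B.leaf (E.apply_tr i j p (hV hp) hj).symm)
    (congrArg B.leaf (E.apply_tr i j p (hV hp) hj).symm)) key2
  simp only [Path.Homotopic.Quotient.cast_cast, Path.Homotopic.Quotient.cast_rfl_rfl] at key3
  exact key3.symm

end RoughEquiv
end

noncomputable section
open SymplecticFibration

variable {O : Type} [TopologicalSpace O]

/-! ### The common affine monodromy sheaf -/

section Common

variable {S₁ S₂ S₃ : IntegrableSystem O}
  {E₁₂ : RoughEquiv S₂ S₁} {E₂₃ : RoughEquiv S₃ S₂} {E₃₁ : RoughEquiv S₁ S₃}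

theorem mem_commonR {V : Opens O} {γ₁ : S₁.LoopSection V} {γ₂ : S₂.LoopSection V}
    {γ₃ : S₃.LoopSection V} :
    (γ₁, γ₂, γ₃) ∈ commonR E₁₂ E₂₃ E₃₁ V ↔ (γ₁ ∈ S₁.R V ∧ γ₂ ∈ S₂.R V ∧ γ₃ ∈ S₃.R V) ∧
      (E₁₂.Corresponds V γ₂ γ₁ ∧ E₂₃.Corresponds V γ₃ γ₂) ∧ E₃₁.Corresponds V γ₁ γ₃ :=
  Iff.rfl

/-- The family is pushed around the triangle through `S₃` to `S₂`. The remaining correspondence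
under `E₁₂` says that the full composite fixes `γ₁`, which holds because that composite is
admissible. -/
theorem exists_mem_commonR (h₁ : S₁.ExactSequence) (h₂ : S₂.ExactSequence)
    (h₃ : S₃.ExactSequence) (hE : RoughEquiv.Compatible E₁₂ E₂₃ E₃₁) {V : Opens O} (i : E₃₁.ι)
    (j : E₂₃.ι) (hi : V ≤ E₃₁.U i) (hj : V ≤ E₂₃.U j) {γ₁ : S₁.LoopSection V}
    (hγ₁ : S₁.IsLoopCell V (LoopSection.cls γ₁)) :
    ∃ γ₂ γ₃, (γ₁, γ₂, γ₃) ∈ commonR E₁₂ E₂₃ E₃₁ V := by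
  obtain ⟨γ₃, hγ₃, h13⟩ := E₃₁.exists_corresponds i hi hγ₁
  obtain ⟨γ₂, hγ₂, h32⟩ := E₂₃.exists_corresponds j hj hγ₃
  refine ⟨γ₂, γ₃, mem_commonR.2 ⟨⟨h₁.exact.toSection_mem_R hγ₁, h₂.exact.toSection_mem_R hγ₂,
    h₃.exact.toSection_mem_R hγ₃⟩, ⟨E₁₂.corresponds_iff.2 fun k p hp hk => ?_, h32⟩, h13⟩⟩
  obtain ⟨q, hq, rfl⟩ : ∃ q, S₃.π q ∈ V ∧ E₂₃.Φ j q = p :=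
    ⟨_, (E₂₃.isLeafMap_symm j).mem' (hj hp) hp, E₂₃.apply_symm_apply j p (hj hp)⟩
  obtain ⟨m, hm, rfl⟩ : ∃ m, S₁.π m ∈ V ∧ E₃₁.Φ i m = q :=
    ⟨_, (E₃₁.isLeafMap_symm i).mem' (hi hq) hq, E₃₁.apply_symm_apply i q (hi hq)⟩
  have hmk : S₁.π m ∈ E₁₂.U k := by
    rwa [E₂₃.π_comp j _ (hj hq), E₃₁.π_comp i _ (hi hm)] at hk
  have hA := hE i j k
  rw [← E₂₃.corresponds_iff.1 h32 j _ hq (hj hq), ← E₃₁.corresponds_iff.1 h13 i m hm (hi hm)]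
  have hmU : S₁.π m ∈ E₃₁.U i ⊓ E₂₃.U j ⊓ E₁₂.U k := ⟨⟨hi hm, hj hm⟩, hmk⟩
  have h31 : IsLeafMap S₁.toSymplecticFibration S₂.toSymplecticFibration (E₃₁.U i ⊓ E₂₃.U j)
      (fun p => E₂₃.Φ j (E₃₁.Φ i p)) :=
    ((E₂₃.isLeafMap j).mono inf_le_right).comp ((E₃₁.isLeafMap i).mono inf_le_left)
  refine (congrArg _ (IsLeafMap.cls_cls _ _ _ _ h31 hmU.1 _)).trans ?_
  refine (IsLeafMap.cls_cls _ h31 hmU.1 _ hA.isLeafMap hmU _).trans ?_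
  exact hA.cls_loop hγ₁ hmU hm _

end Common

/-! ### Cocycles of leaf maps up to continuous families of paths -/

/-- Leaf maps `f x` over the members of a covering, with cells `α x y` from `f x` to `f y` that
satisfy the cocycle condition up to the loop classes `ρ x y z`. -/
structure IsCocycle (A B : SymplecticFibration O) (V : O → Opens O) (f : O → A.M → B.M)
    (α : ∀ x y p, A.π p ∈ V x ⊓ V y → B.PathClass (f x p) (f y p))
    (ρ : ∀ x y z q, B.π q ∈ V x ⊓ V y ⊓ V z → B.PathClass q q) : Prop where
  leafMap : ∀ x, IsLeafMap A B (V x) (f x)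
  cell : ∀ x y, IsCell A B (V x ⊓ V y) (f x) (f y) (α x y)
  loop : ∀ x y z, B.IsLoopCell (V x ⊓ V y ⊓ V z) (ρ x y z)
  trans_eq : ∀ x y z p (hp : A.π p ∈ V x ⊓ V y ⊓ V z),
    α x y p hp.1 ⬝ α y z p ⟨hp.1.2, hp.2⟩ =
      ρ x y z (f x p) ((leafMap x).mem' hp.1.1 hp) ⬝ α x z p ⟨hp.1.1, hp.2⟩

namespace IsCocycle

variable {A B C : SymplecticFibration O} {V W : O → Opens O} {f : O → A.M → B.M}
  {α : ∀ x y p, A.π p ∈ V x ⊓ V y → B.PathClass (f x p) (f y p)}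
  {ρ : ∀ x y z q, B.π q ∈ V x ⊓ V y ⊓ V z → B.PathClass q q}

theorem mono (h : IsCocycle A B V f α ρ) (hW : ∀ x, W x ≤ V x) :
    IsCocycle A B W f (fun x y p hp => α x y p (inf_le_inf (hW x) (hW y) hp))
      (fun x y z q hq => ρ x y z q (inf_le_inf (inf_le_inf (hW x) (hW y)) (hW z) hq)) where
  leafMap x := (h.leafMap x).mono (hW x)
  cell x y := (h.cell x y).mono (inf_le_inf (hW x) (hW y))
  loop x y z := (h.loop x y z).mono (inf_le_inf (inf_le_inf (hW x) (hW y)) (hW z))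
  trans_eq x y z p hp := h.trans_eq x y z p (inf_le_inf (inf_le_inf (hW x) (hW y)) (hW z) hp)

/-- Composition of homotopies: first `g_x` applied to `α_xy`, then `β_xy` at `f_y p`. The family
`ρ'` is the image of `ρ` under the `g_x`. -/
theorem comp (hf : IsCocycle A B V f α ρ) {g : O → B.M → C.M}
    {β : ∀ x y q, B.π q ∈ V x ⊓ V y → C.PathClass (g x q) (g y q)}
    {σ' ρ' : ∀ x y z q, C.π q ∈ V x ⊓ V y ⊓ V z → C.PathClass q q}
    (hg : IsCocycle B C V g β σ') (hρ' : ∀ x y z, C.IsLoopCell (V x ⊓ V y ⊓ V z) (ρ' x y z))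
    (hρρ' : ∀ x y z q (hq : B.π q ∈ V x ⊓ V y ⊓ V z),
      (hg.leafMap x).cls hq.1.1 (ρ x y z q hq) =
        ρ' x y z (g x q) ((hg.leafMap x).mem' hq.1.1 hq)) :
    IsCocycle A C V (fun x p => g x (f x p))
      (fun x y p hp => (hg.leafMap x).cls ((hf.leafMap x).mem hp.1) (α x y p hp) ⬝
        β x y (f y p) ((hf.leafMap y).mem' hp.2 hp))
      (fun x y z q hq => ρ' x y z q hq ⬝ σ' x y z q hq) where
  leafMap x := (hg.leafMap x).comp (hf.leafMap x)
  cell x y := ((hf.cell x y).map ((hg.leafMap x).mono inf_le_left)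
    ((hf.leafMap x).mono inf_le_left)).trans
      ((hg.cell x y).comp ((hf.leafMap y).mono inf_le_right))
  loop x y z := (hρ' x y z).trans (hg.loop x y z)
  trans_eq x y z p hp := by
    have hfx := (hf.leafMap x).mem' hp.1.1 hp
    have hfy := (hf.leafMap y).mem' hp.1.2 hp
    have hfz := (hf.leafMap z).mem' hp.2 hp
    -- Interchange law: naturality of `β_xy` along `α_yz` brings the two `α` factors together and
    -- the two `β` factors together.
    have hnat : (hg.leafMap x).cls hfy.1.1 (α y z p ⟨hp.1.2, hp.2⟩) ⬝ β x y (f z p) hfz.1 =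
        β x y (f y p) hfy.1 ⬝ (hg.leafMap y).cls hfy.1.2 (α y z p ⟨hp.1.2, hp.2⟩) :=
      (hg.cell x y).natural (V := V x ⊓ V y) ((hg.leafMap x).mono inf_le_left)
      ((hg.leafMap y).mono inf_le_right) le_rfl hfy.1 hfz.1 (α y z p ⟨hp.1.2, hp.2⟩)
    have hf1 := congrArg ((hg.leafMap x).cls hfx.1.1) (hf.trans_eq x y z p hp)
    rw [IsLeafMap.cls_trans _ hfx.1.1 hfy.1.1, IsLeafMap.cls_trans _ hfx.1.1 hfx.1.1,
      hρρ'] at hf1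
    have hg1 := hg.trans_eq x y z (f z p) hfz
    -- The defect of `g` appears at `g_x (f_z p)` and has to be slid back to `g_x (f_x p)`.
    have hσ := (hg.loop x y z).natural ((hg.leafMap x).mem' hfx.1.1 hfx)
      ((hg.leafMap x).mem' hfz.1.1 hfz)
      ((hg.leafMap x).cls hfx.1.1 (α x z p ⟨hp.1.1, hp.2⟩))
    calc _ = (hg.leafMap x).cls hfx.1.1 (α x y p hp.1) ⬝
          (β x y (f y p) hfy.1 ⬝ (hg.leafMap y).cls hfy.1.2 (α y z p ⟨hp.1.2, hp.2⟩)) ⬝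
          β y z (f z p) ⟨hfz.1.2, hfz.2⟩ := by
            simp only [Path.Homotopic.Quotient.trans_assoc]
      _ = ((hg.leafMap x).cls hfx.1.1 (α x y p hp.1) ⬝
          (hg.leafMap x).cls hfy.1.1 (α y z p ⟨hp.1.2, hp.2⟩)) ⬝
          (β x y (f z p) hfz.1 ⬝ β y z (f z p) ⟨hfz.1.2, hfz.2⟩) := by
            refine (congrArg (fun e => _ ⬝ e ⬝ _) hnat.symm).trans ?_
            simp only [Path.Homotopic.Quotient.trans_assoc]
      _ = _ := by
            rw [hf1, hg1, Path.Homotopic.Quotient.trans_assoc,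
              ← Path.Homotopic.Quotient.trans_assoc _ (σ' x y z _ _), hσ]
            simp only [Path.Homotopic.Quotient.trans_assoc]

/-- The defect of a cocycle of leaf maps that are onto is a two-cocycle. -/
theorem defect (h : IsCocycle A B V f α ρ) (x y z w : O) (p : A.M)
    (hp : A.π p ∈ V x ⊓ V y ⊓ V z ⊓ V w) {q : B.M} (hq : f x p = q)
    (hq' : B.π q ∈ V x ⊓ V y ⊓ V z ⊓ V w) :
    ρ x y z q hq'.1 ⬝ ρ x z w q ⟨⟨hq'.1.1.1, hq'.1.2⟩, hq'.2⟩ =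
      ρ y z w q ⟨⟨hq'.1.1.2, hq'.1.2⟩, hq'.2⟩ ⬝ ρ x y w q ⟨hq'.1.1, hq'.2⟩ := by
  subst hq
  have h1 := h.trans_eq x y z p hp.1
  have h2 := h.trans_eq x z w p ⟨⟨hp.1.1.1, hp.1.2⟩, hp.2⟩
  have h3 := h.trans_eq y z w p ⟨⟨hp.1.1.2, hp.1.2⟩, hp.2⟩
  have h4 := h.trans_eq x y w p ⟨hp.1.1, hp.2⟩
  -- The triple product `α_xy ⬝ α_yz ⬝ α_zw` is reduced to a multiple of `α_xw` in two ways; one of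
  -- them produces `ρ_yzw` at `f_y p`, which is slid along `α_xy` to `f_x p`.
  have h5 := (h.loop y z w).natural (p := f x p) (q := f y p)
    ⟨⟨hq'.1.1.2, hq'.1.2⟩, hq'.2⟩
    ((h.leafMap y).mem' hp.1.1.2 ⟨⟨hp.1.1.2, hp.1.2⟩, hp.2⟩) (α x y p hp.1.1)
  apply Path.Homotopic.Quotient.trans_right_cancel (c := α x w p ⟨hp.1.1.1, hp.2⟩)
  rw [Path.Homotopic.Quotient.trans_assoc, ← h2, ← Path.Homotopic.Quotient.trans_assoc, ← h1,
    Path.Homotopic.Quotient.trans_assoc, h3, ← Path.Homotopic.Quotient.trans_assoc, h5,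
    Path.Homotopic.Quotient.trans_assoc, h4, ← Path.Homotopic.Quotient.trans_assoc]

end IsCocycle

/-- If the leaf maps of a cocycle are connected to the identity, the defect of the cocycle is the
coboundary of continuous families of loop classes. -/
theorem IsCocycle.trivialize {A : SymplecticFibration O} {V : O → Opens O} {f : O → A.M → A.M}
    {α : ∀ x y p, A.π p ∈ V x ⊓ V y → A.PathClass (f x p) (f y p)}
    {ρ : ∀ x y z q, A.π q ∈ V x ⊓ V y ⊓ V z → A.PathClass q q}
    (h : IsCocycle A A V f α ρ) (a : ∀ x p, A.π p ∈ V x → A.PathClass p (f x p))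
    (ha : ∀ x, IsCell A A (V x) (fun p => p) (f x) (a x)) :
    ∃ s : ∀ x y p, A.π p ∈ V x ⊓ V y → A.PathClass p p,
      (∀ x y, A.IsLoopCell (V x ⊓ V y) (s x y)) ∧
      ∀ x y z p (hp : A.π p ∈ V x ⊓ V y ⊓ V z),
        s x y p hp.1 ⬝ s y z p ⟨hp.1.2, hp.2⟩ = ρ x y z p hp ⬝ s x z p ⟨hp.1.1, hp.2⟩ := by
  refine ⟨fun x y p hp => a x p hp.1 ⬝ α x y p hp ⬝ (a y p hp.2).symm, fun x y => ?_,
    fun x y z p hp => ?_⟩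
  · exact (((ha x).mono inf_le_left).trans (h.cell x y)).trans ((ha y).mono inf_le_right).symm
  · have hn := (h.loop x y z).natural hp ((h.leafMap x).mem' hp.1.1 hp) (a x p hp.1.1)
    have ht := h.trans_eq x y z p hp
    calc _ = a x p hp.1.1 ⬝ (α x y p hp.1 ⬝ α y z p ⟨hp.1.2, hp.2⟩) ⬝ (a z p hp.2).symm := by
          simp only [Path.Homotopic.Quotient.trans_assoc]
          rw [← Path.Homotopic.Quotient.trans_assoc (a y p hp.1.2).symm,
            Path.Homotopic.Quotient.symm_trans, Path.Homotopic.Quotient.refl_trans]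
      _ = _ := by
          rw [ht, ← Path.Homotopic.Quotient.trans_assoc, hn]
          simp only [Path.Homotopic.Quotient.trans_assoc]

/-! ### The cocycle of a system of lifts of the transition homeomorphisms -/

namespace RoughEquiv

variable {A B : IntegrableSystem O} (E : RoughEquiv A B)

/-- The image under `Φ i` of a lift of `(Φ i)⁻¹ ∘ Φ j`: path classes from `Φ i p` to `Φ j p`. -/
def liftCell {V : Opens O} (i j : E.ι) (hi : V ≤ E.U i) (hj : V ≤ E.U j)
    (ψ : A.Lift V (E.tr i j)) (p : A.M) (hp : A.π p ∈ V) : B.PathClass (E.Φ i p) (E.Φ j p) :=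
  ((E.isLeafMap i).cls (hi hp) (ψ.cls p hp)).cast rfl
    (congrArg B.leaf (E.apply_tr i j p (hi hp) (hj hp)).symm)

theorem isCell_liftCell {V : Opens O} (i j : E.ι) (hi : V ≤ E.U i) (hj : V ≤ E.U j)
    (ψ : A.Lift V (E.tr i j)) :
    IsCell A.toSymplecticFibration B.toSymplecticFibration V (E.Φ i) (E.Φ j)
      (E.liftCell i j hi hj ψ) :=
  (IsCell.map ((E.isLeafMap i).mono hi) (IsLeafMap.id V)
    (continuousClasses_iff.1 ψ.continuous_cls)).cast (fun _ _ => rfl)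
    (fun p hp => (E.apply_tr i j p (hi hp) (hj hp)).symm)

/-- The product in `Â_t` is twisted: the class of `ψ_xy` is taken at the moved point `φ_yz p`.
Naturality of `α_xy` along the class of `ψ_yz` replaces it by the value at `p`, turning the twisted
product into plain concatenation of cells in `B`. -/
theorem isCocycle_liftCell (V : O → Opens O) (τ : O → E.ι) (hτ : ∀ x, V x ≤ E.U (τ x))
    (ψ : ∀ x y, A.Lift (V x ⊓ V y) (E.tr (τ x) (τ y)))
    (γ : ∀ x y z, A.LoopSection (V x ⊓ V y ⊓ V z)) (γ' : ∀ x y z, B.LoopSection (V x ⊓ V y ⊓ V z))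
    (hγ' : ∀ x y z, B.IsLoopCell _ (LoopSection.cls (γ' x y z)))
    (hγγ' : ∀ x y z, E.Corresponds _ (γ x y z) (γ' x y z))
    (hψ : ∀ (x y z : O) (p : A.M) (hp : A.π p ∈ V x ⊓ V y ⊓ V z),
      ((ψ y z).cls p ⟨hp.1.2, hp.2⟩).trans
          ((ψ x y).cls (E.tr (τ y) (τ z) p)
            (by rw [E.π_tr _ _ p (hτ y hp.1.2) (hτ z hp.2)]; exact hp.1)) =
        ((LoopSection.cls (γ x y z) p hp).trans
          ((ψ x z).cls p ⟨hp.1.1, hp.2⟩)).cast rfl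
            (congrArg A.leaf (E.tr_tr _ _ _ p (hτ y hp.1.2) (hτ z hp.2)))) :
    IsCocycle A.toSymplecticFibration B.toSymplecticFibration V (fun x => E.Φ (τ x))
      (fun x y => E.liftCell (τ x) (τ y) (inf_le_left.trans (hτ x)) (inf_le_right.trans (hτ y))
        (ψ x y))
      (fun x y z => LoopSection.cls (γ' x y z)) where
  leafMap x := (E.isLeafMap (τ x)).mono (hτ x)
  cell x y := E.isCell_liftCell _ _ _ _ _
  loop x y z := hγ' x y z
  trans_eq x y z p hp := by
    have hx := hτ x hp.1.1
    have hy := hτ y hp.1.2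
    have hz := hτ z hp.2
    have hq : A.π (E.tr (τ y) (τ z) p) = A.π p := E.π_tr _ _ p hy hz
    have hqV : A.π (E.tr (τ y) (τ z) p) ∈ V x ⊓ V y ⊓ V z := by rwa [hq]
    have hΦx := (E.isLeafMap (τ x)).mono (hτ x)
    have hnat := (E.isCell_liftCell (τ x) (τ y) (inf_le_left.trans (hτ x))
      (inf_le_right.trans (hτ y)) (ψ x y)).natural (V := V x ⊓ V y)
      ((E.isLeafMap (τ x)).mono (inf_le_left.trans (hτ x)))
      ((E.isLeafMap (τ y)).mono (inf_le_right.trans (hτ y))) le_rfl hp.1 hqV.1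
      ((ψ y z).cls p ⟨hp.1.2, hp.2⟩)
    have hc := congrArg (hΦx.cls hp.1.1) (hψ x y z p hp)
    rw [hΦx.cls_trans hp.1.1 hqV.1.1,
      hΦx.cls_cast hp.1.1 hp.1.1 rfl (E.tr_tr _ _ _ p hy hz), hΦx.cls_trans hp.1.1 hp.1.1] at hc
    have hr := E.corresponds_iff.1 (hγγ' x y z) (τ x) p hp hx
    calc _ = (E.liftCell (τ x) (τ y) (inf_le_left.trans (hτ x)) (inf_le_right.trans (hτ y))
            (ψ x y) p hp.1 ⬝ (E.isLeafMap (τ y)).cls hy ((ψ y z).cls p ⟨hp.1.2, hp.2⟩)).cast rfl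
            (congrArg B.leaf (E.apply_tr _ _ p hy hz).symm) :=
          (Path.Homotopic.Quotient.trans_cast _ _ _).symm
      _ = ((hΦx.cls hp.1.1 ((ψ y z).cls p ⟨hp.1.2, hp.2⟩) ⬝
            hΦx.cls hqV.1.1 ((ψ x y).cls (E.tr (τ y) (τ z) p) hqV.1)).cast rfl
              (congrArg B.leaf (E.apply_tr _ _ _ (hτ x hqV.1.1) (hτ y hqV.1.2)).symm)).cast rfl
            (congrArg B.leaf (E.apply_tr _ _ p hy hz).symm) :=
          congrArg (fun e => Path.Homotopic.Quotient.cast e rfl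
            (congrArg B.leaf (E.apply_tr _ _ p hy hz).symm))
            (hnat.symm.trans (Path.Homotopic.Quotient.trans_cast _ _ _).symm)
      _ = LoopSection.cls (γ' x y z) (E.Φ (τ x) p) _ ⬝
            (hΦx.cls hp.1.1 ((ψ x z).cls p ⟨hp.1.1, hp.2⟩)).cast rfl
              (congrArg B.leaf (E.apply_tr _ _ p hx hz).symm) := by
          rw [hc, Path.Homotopic.Quotient.cast_cast, Path.Homotopic.Quotient.cast_cast, ← hr,
            ← Path.Homotopic.Quotient.trans_cast]
          rfl

end RoughEquiv
end

noncomputable section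
open SymplecticFibration

variable {O : Type} [TopologicalSpace O]

/-! ### Existence of the Chern class -/

/-- On a paracompact Hausdorff space, a property of pairs of members of an open covering that holds
locally on their intersection holds on the pairwise intersections of a suitable refinement. -/
theorem PointedCover.exists_pairwise [T2Space O] [ParacompactSpace O] {ι : Type} (U : ι → Opens O)
    (hU : ∀ x, ∃ i, x ∈ U i) (P : ι → ι → Opens O → Prop)
    (mono : ∀ i j V W, W ≤ V → P i j V → P i j W) (bot : ∀ i j, P i j ⊥)
    (exists_local : ∀ i j x, x ∈ U i → x ∈ U j → ∃ V : Opens O, x ∈ V ∧ P i j V)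
    (𝒰 : PointedCover O) :
    ∃ (𝒱 : PointedCover O) (τ : O → ι), 𝒰 ≤ 𝒱 ∧ (∀ x, 𝒱.V x ≤ U (τ x)) ∧
      ∀ x y, P (τ x) (τ y) (𝒱.V x ⊓ 𝒱.V y) := by
  obtain ⟨v, vo, vU, vf, vu⟩ := precise_refinement (fun i => (U i : Set O))
    (fun i => (U i).isOpen) (Set.iUnion_eq_univ_iff.2 hU)
  obtain ⟨w, wU, wo, wv⟩ := exists_iUnion_eq_closure_subset vo (fun x => vf.point_finite x) vU
  -- Choosing indices from the shrunken covering `w` lets `closure (w i)` decide which indices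
  -- matter near a point.
  choose τ hτ using Set.iUnion_eq_univ_iff.1 wU
  have hwU : ∀ i, closure (w i) ⊆ U i := fun i => (wv i).trans (vu i)
  have hτU : ∀ x, x ∈ U (τ x) := fun x => hwU _ (subset_closure (hτ x))
  choose N hN hNf using vf
  have key : ∀ x i, ∃ V : Opens O, x ∈ V ∧
      (P (τ x) i V ∨ Disjoint (V : Set O) (closure (w i))) := by
    intro x i
    by_cases hx : x ∈ closure (w i)
    · obtain ⟨V, hxV, hV⟩ := exists_local (τ x) i x (hτU x) (hwU i hx)
      exact ⟨V, hxV, Or.inl hV⟩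
    · exact ⟨⟨(closure (w i))ᶜ, isClosed_closure.isOpen_compl⟩, hx, Or.inr disjoint_compl_left⟩
  choose K hK hKP using key
  refine ⟨⟨fun x => 𝒰.V x ⊓ ⟨w (τ x), wo _⟩ ⊓ ⟨interior (N x), isOpen_interior⟩ ⊓
    ⟨⋂ i ∈ (hNf x).toFinset, (K x i : Set O), isOpen_biInter_finset fun i _ => (K x i).isOpen⟩,
    fun x => ⟨⟨⟨𝒰.mem x, hτ x⟩, mem_interior_iff_mem_nhds.2 (hN x)⟩,
      Set.mem_iInter₂.2 fun i _ => hK x i⟩⟩, τ, fun x => ?_, fun x => ?_, fun x y => ?_⟩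
  · exact inf_le_left.trans (inf_le_left.trans inf_le_left)
  · exact fun z hz => hwU _ (subset_closure hz.1.1.2)
  · set V : Opens O := _ ⊓ _ with hVdef
    by_cases hV : V = ⊥
    · rw [hV]; exact bot _ _
    obtain ⟨z, hz⟩ := (Opens.ne_bot_iff_nonempty V).1 hV
    have hzx := hz.1
    have hzy := hz.2
    -- The common point `z` lies in `N x` and in `w (τ y)`, so `τ y` is among the finitely many
    -- indices handled at `x`, and `z` excludes the disjoint alternative.
    have hi : τ y ∈ (hNf x).toFinset := (Set.Finite.mem_toFinset _).2
      ⟨z, wv _ (subset_closure hzy.1.1.2), interior_subset hzx.1.2⟩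
    rcases hKP x (τ y) with h | h
    · exact mono _ _ _ _ (fun u hu => Set.mem_iInter₂.1 hu.1.2 _ hi) h
    · exact absurd (subset_closure hzy.1.1.2)
        (Set.disjoint_left.1 h (Set.mem_iInter₂.1 hzx.2 _ hi))

/-- Restriction of lifts. -/
def SymplecticFibration.Lift.mono {S : SymplecticFibration O} {U V : Opens O} {f : S.M → S.M}
    (ψ : S.Lift U f) (h : V ≤ U) : S.Lift V f :=
  ⟨fun p hp => ψ.cls p (h hp), IsCell.mono (continuousClasses_iff.1 ψ.continuous_cls) h⟩

namespace RoughEquiv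

variable {A B : IntegrableSystem O} (E : RoughEquiv A B)

theorem exists_lifts [T2Space O] [ParacompactSpace O] (hA : A.ExactSequence)
    (𝒰 : PointedCover O) :
    ∃ (𝒱 : PointedCover O) (τ : O → E.ι), 𝒰 ≤ 𝒱 ∧ (∀ x, 𝒱.V x ≤ E.U (τ x)) ∧
      ∀ x y, Nonempty (A.Lift (𝒱.V x ⊓ 𝒱.V y) (E.tr (τ x) (τ y))) := by
  refine PointedCover.exists_pairwise E.U E.cover
    (fun i j V => Nonempty (A.Lift V (E.tr i j))) ?_ ?_ ?_ 𝒰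
  · rintro i j V W h ⟨ψ⟩
    exact ⟨ψ.mono h⟩
  · exact fun i j => ⟨⟨fun p hp => hp.elim, fun ψ hψ => (hψ 0).elim⟩⟩
  · intro i j x hi hj
    obtain ⟨V, hx, -, hV⟩ := hA.lifts _ _ (E.admissible i j) x ⟨hi, hj⟩
    exact ⟨V, hx, hV⟩

/-- The coefficients `F` are kept abstract, with readings `compA` and `compB` in both systems, so
that one argument serves all three sides of the triangle. The defect of the lifts is read in `A`,
its cocycle identity in `B`. -/
theorem exists_isChernClass [T2Space O] [ParacompactSpace O] (hA : A.ExactSequence)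
    {F : (Opens O)ᵒᵖ ⥤ AddCommGrpCat.{0}} (compA : ∀ V : Opens O, F.obj (op V) → A.LoopSection V)
    (compB : ∀ V : Opens O, F.obj (op V) → B.LoopSection V) (𝒰 : PointedCover O)
    (ext : ∀ x V, V ≤ 𝒰.V x → ∀ γ : A.LoopSection V, A.IsLoopCell V (LoopSection.cls γ) →
      ∃ s, compA V s = γ)
    (corr : ∀ V s, E.Corresponds V (compA V s) (compB V s))
    (cell : ∀ V s, B.IsLoopCell V (LoopSection.cls (compB V s)))
    (inj : ∀ V, Function.Injective (compB V))
    (add : ∀ V s t, compB V (s + t) = compB V s * compB V t)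
    (res : ∀ (V W : Opens O) (h : W ≤ V) s, compB W (Cech.res F h s) = B.resLoop h (compB V s)) :
    ∃ c, E.IsChernClass compA c := by
  obtain ⟨𝒱, τ, h𝒱, hτ, hψ⟩ := E.exists_lifts hA 𝒰
  let ψ : ∀ x y, A.Lift (𝒱.V x ⊓ 𝒱.V y) (E.tr (τ x) (τ y)) := fun x y => (hψ x y).some
  have htr : ∀ x y z, ∀ p, A.π p ∈ 𝒱.V x ⊓ 𝒱.V y ⊓ 𝒱.V z →
      E.tr (τ x) (τ y) (E.tr (τ y) (τ z) p) = E.tr (τ x) (τ z) p := fun x y z p hp =>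
    E.tr_tr _ _ _ p (hτ y hp.1.2) (hτ z hp.2)
  have hπ : ∀ x y z, ∀ p, A.π p ∈ 𝒱.V x ⊓ 𝒱.V y ⊓ 𝒱.V z →
      A.π (E.tr (τ y) (τ z) p) ∈ 𝒱.V x ⊓ 𝒱.V y := fun x y z p hp => by
    rw [E.π_tr _ _ p (hτ y hp.1.2) (hτ z hp.2)]; exact hp.1
  let γ : ∀ x y z p, A.π p ∈ 𝒱.V x ⊓ 𝒱.V y ⊓ 𝒱.V z → A.PathClass p p := fun x y z p hp =>
    ((ψ y z).cls p ⟨hp.1.2, hp.2⟩ ⬝ (ψ x y).cls (E.tr (τ y) (τ z) p) (hπ x y z p hp)).cast rfl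
      (congrArg A.leaf (htr x y z p hp).symm) ⬝ ((ψ x z).cls p ⟨hp.1.1, hp.2⟩).symm
  have hγ : ∀ x y z, A.IsLoopCell _ (γ x y z) := fun x y z => by
    have htrm : IsLeafMap A.toSymplecticFibration A.toSymplecticFibration
        (𝒱.V x ⊓ 𝒱.V y ⊓ 𝒱.V z) (E.tr (τ y) (τ z)) := (E.isLeafMap_tr _ _).mono
      fun u hu => ⟨hτ y hu.1.2, hτ z hu.2⟩
    have h1 := (continuousClasses_iff.1 (ψ y z).continuous_cls).mono (Cech.le_yz (𝒱.V x) _ _)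
    have h2 := ((continuousClasses_iff.1 (ψ x y).continuous_cls).mono
      (Cech.le_xy _ _ (𝒱.V z))).comp htrm
    have h3 := (continuousClasses_iff.1 (ψ x z).continuous_cls).mono (Cech.le_xz _ (𝒱.V y) _)
    exact ((h1.trans h2).cast (fun _ _ => rfl) fun p hp => (htr x y z p hp).symm).trans h3.symm
  choose r hr using fun x y z => ext x _ (inf_le_left.trans (inf_le_left.trans (h𝒱 x)))
    (hγ x y z).toSection (hγ x y z)
  have hrel : ∀ (x y z : O) (p : A.M) (hp : A.π p ∈ 𝒱.V x ⊓ 𝒱.V y ⊓ 𝒱.V z),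
      (ψ y z).cls p ⟨hp.1.2, hp.2⟩ ⬝ (ψ x y).cls (E.tr (τ y) (τ z) p) (hπ x y z p hp) =
        (LoopSection.cls (compA _ (r x y z)) p hp ⬝ (ψ x z).cls p ⟨hp.1.1, hp.2⟩).cast rfl
            (congrArg A.leaf (htr x y z p hp)) := fun x y z p hp => by
    rw [hr, IsLoopCell.cls_toSection, Path.Homotopic.Quotient.trans_assoc,
      Path.Homotopic.Quotient.symm_trans, Path.Homotopic.Quotient.trans_refl,
      Path.Homotopic.Quotient.cast_cast, Path.Homotopic.Quotient.cast_rfl_rfl]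
  have hcoc := E.isCocycle_liftCell 𝒱.V τ hτ ψ (fun x y z => compA _ (r x y z))
    (fun x y z => compB _ (r x y z)) (fun x y z => cell _ _) (fun x y z => corr _ _) hrel
  have hZ : (r : Cech.C2 F 𝒱) ∈ Cech.Z2 F 𝒱 := by
    rw [AddMonoidHom.mem_ker]
    funext x y z w
    -- Written without subtraction, the identity translates into products of loop classes.
    suffices h : Cech.res F (Cech.le_yzw _ _ _ _) (r y z w) +
        Cech.res F (Cech.le_xyw _ _ _ _) (r x y w) =
        Cech.res F (Cech.le_xyz _ _ _ _) (r x y z) +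
        Cech.res F (Cech.le_xzw (𝒱.V x) (𝒱.V y) (𝒱.V z) (𝒱.V w)) (r x z w) by
      change Cech.res F _ (r y z w) - Cech.res F _ (r x z w) + Cech.res F _ (r x y w) -
        Cech.res F _ (r x y z) = 0
      rw [sub_add_eq_add_sub, h]
      abel
    apply inj
    rw [add, add, res, res, res, res]
    refine LoopSection.ext_cls fun q hq => ?_
    rw [LoopSection.cls_mul, LoopSection.cls_mul]
    have hqx := hτ x hq.1.1.1
    -- Every point `q` of `B` over the quadruple intersection has the form `Φ_x p`, so the defect
    -- identity covers all of it.
    exact (hcoc.defect x y z w ((E.Φ (τ x)).symm q)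
      ((E.isLeafMap_symm (τ x)).mem' hqx hq) (E.apply_symm_apply _ q hqx) hq).symm
  exact ⟨_, 𝒱, τ, hτ, ψ, ⟨r, hZ⟩, hrel, rfl⟩

end RoughEquiv
end

noncomputable section
open SymplecticFibration

variable {O : Type} [TopologicalSpace O]

/-! ### Čech classes in the direct limit -/

namespace Cech

variable (F : (Opens O)ᵒᵖ ⥤ AddCommGrpCat.{0}) {𝒱 𝒲 : PointedCover O}

theorem H2.mk_resZ2 (h : 𝒱 ≤ 𝒲) (r : Z2 F 𝒱) : H2.mk F (resZ2 F h r) = H2.mk F r := by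
  classical
  exact AddCommGroup.DirectLimit.of_f (G := H2Cover F) (f := resH2 F) h (QuotientAddGroup.mk r)

theorem H2.mk_add (r s : Z2 F 𝒱) : H2.mk F (r + s) = H2.mk F r + H2.mk F s := by
  classical
  exact map_add (AddCommGroup.DirectLimit.of (H2Cover F) (resH2 F) 𝒱)
    (QuotientAddGroup.mk r) (QuotientAddGroup.mk s)

theorem H2.mk_eq_zero (r : Z2 F 𝒱) (b : C1 F 𝒱) (h : d1 F 𝒱 b = r.1) : H2.mk F r = 0 := by
  classical
  have : (QuotientAddGroup.mk r : H2Cover F 𝒱) = 0 :=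
    (QuotientAddGroup.eq_zero_iff r).2 ⟨b, h⟩
  exact (congrArg (AddCommGroup.DirectLimit.of (H2Cover F) (resH2 F) 𝒱) this).trans (map_zero _)

end Cech

/-! ### The triangle of three systems -/

section Three

variable {S₁ S₂ S₃ : IntegrableSystem O}
  {E₁₂ : RoughEquiv S₂ S₁} {E₂₃ : RoughEquiv S₃ S₂} {E₃₁ : RoughEquiv S₁ S₃}

theorem comp_mem (V : Opens O) (s : (commonSheaf E₁₂ E₂₃ E₃₁).obj (op V)) :
    (comp₁ E₁₂ E₂₃ E₃₁ V s, comp₂ E₁₂ E₂₃ E₃₁ V s, comp₃ E₁₂ E₂₃ E₃₁ V s) ∈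
      commonR E₁₂ E₂₃ E₃₁ V :=
  (Additive.toMul (α := commonR E₁₂ E₂₃ E₃₁ V) s).2

theorem corresponds_comp₁₂ (V : Opens O) (s : (commonSheaf E₁₂ E₂₃ E₃₁).obj (op V)) :
    E₁₂.Corresponds V (comp₂ E₁₂ E₂₃ E₃₁ V s) (comp₁ E₁₂ E₂₃ E₃₁ V s) :=
  (mem_commonR.1 (comp_mem V s)).2.1.1

theorem corresponds_comp₂₃ (V : Opens O) (s : (commonSheaf E₁₂ E₂₃ E₃₁).obj (op V)) :
    E₂₃.Corresponds V (comp₃ E₁₂ E₂₃ E₃₁ V s) (comp₂ E₁₂ E₂₃ E₃₁ V s) :=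
  (mem_commonR.1 (comp_mem V s)).2.1.2

theorem corresponds_comp₃₁ (V : Opens O) (s : (commonSheaf E₁₂ E₂₃ E₃₁).obj (op V)) :
    E₃₁.Corresponds V (comp₁ E₁₂ E₂₃ E₃₁ V s) (comp₃ E₁₂ E₂₃ E₃₁ V s) :=
  (mem_commonR.1 (comp_mem V s)).2.2

theorem isLoopCell_comp₁ (V : Opens O) (s : (commonSheaf E₁₂ E₂₃ E₃₁).obj (op V)) :
    S₁.IsLoopCell V (LoopSection.cls (comp₁ E₁₂ E₂₃ E₃₁ V s)) :=
  isLoopCell_of_mem_R (mem_commonR.1 (comp_mem V s)).1.1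

theorem isLoopCell_comp₂ (V : Opens O) (s : (commonSheaf E₁₂ E₂₃ E₃₁).obj (op V)) :
    S₂.IsLoopCell V (LoopSection.cls (comp₂ E₁₂ E₂₃ E₃₁ V s)) :=
  isLoopCell_of_mem_R (mem_commonR.1 (comp_mem V s)).1.2.1

theorem isLoopCell_comp₃ (V : Opens O) (s : (commonSheaf E₁₂ E₂₃ E₃₁).obj (op V)) :
    S₃.IsLoopCell V (LoopSection.cls (comp₃ E₁₂ E₂₃ E₃₁ V s)) :=
  isLoopCell_of_mem_R (mem_commonR.1 (comp_mem V s)).1.2.2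

/-- Correspondence determines the component in `S₃` from that in `S₁`, and then the one in `S₂`.
Thus identities in the common sheaf may be tested in a single system. -/
theorem comp₁_injective (V : Opens O) : Function.Injective (comp₁ E₁₂ E₂₃ E₃₁ V) := by
  intro s t h
  have h3 : comp₃ E₁₂ E₂₃ E₃₁ V s = comp₃ E₁₂ E₂₃ E₃₁ V t :=
    (corresponds_comp₃₁ V s).right_injective (h ▸ corresponds_comp₃₁ V t)
  have h2 : comp₂ E₁₂ E₂₃ E₃₁ V s = comp₂ E₁₂ E₂₃ E₃₁ V t :=
    (corresponds_comp₂₃ V s).right_injective (h3 ▸ corresponds_comp₂₃ V t)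
  exact Subtype.ext (Prod.ext h (Prod.ext h2 h3))

theorem comp₃_injective (V : Opens O) : Function.Injective (comp₃ E₁₂ E₂₃ E₃₁ V) :=
  fun s t h => comp₁_injective V
    ((corresponds_comp₃₁ V s).left_injective (h ▸ corresponds_comp₃₁ V t))

theorem comp₂_injective (V : Opens O) : Function.Injective (comp₂ E₁₂ E₂₃ E₃₁ V) :=
  fun s t h => comp₁_injective V
    ((corresponds_comp₁₂ V s).right_injective (h ▸ corresponds_comp₁₂ V t))

theorem exists_comp₁_eq (h₁ : S₁.ExactSequence) (h₂ : S₂.ExactSequence) (h₃ : S₃.ExactSequence)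
    (hE : RoughEquiv.Compatible E₁₂ E₂₃ E₃₁) {V : Opens O} (i : E₃₁.ι) (j : E₂₃.ι)
    (hi : V ≤ E₃₁.U i) (hj : V ≤ E₂₃.U j) (γ : S₁.LoopSection V)
    (hγ : S₁.IsLoopCell V (LoopSection.cls γ)) : ∃ s, comp₁ E₁₂ E₂₃ E₃₁ V s = γ := by
  obtain ⟨γ₂, γ₃, h⟩ := exists_mem_commonR h₁ h₂ h₃ hE i j hi hj hγ
  exact ⟨Additive.ofMul (⟨(γ, γ₂, γ₃), h⟩ : commonR E₁₂ E₂₃ E₃₁ V), rfl⟩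

/-- The family is pushed to `S₁` and extended to a triple there; its component in `S₂` is the
original family, since correspondence is injective. -/
theorem exists_comp₂_eq (h₁ : S₁.ExactSequence) (h₂ : S₂.ExactSequence) (h₃ : S₃.ExactSequence)
    (hE : RoughEquiv.Compatible E₁₂ E₂₃ E₃₁) {V : Opens O} (i : E₃₁.ι) (j : E₂₃.ι) (k : E₁₂.ι)
    (hi : V ≤ E₃₁.U i) (hj : V ≤ E₂₃.U j) (hk : V ≤ E₁₂.U k) (γ : S₂.LoopSection V)
    (hγ : S₂.IsLoopCell V (LoopSection.cls γ)) : ∃ s, comp₂ E₁₂ E₂₃ E₃₁ V s = γ := by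
  obtain ⟨γ₁, hγ₁, h⟩ := E₁₂.exists_corresponds k hk hγ
  obtain ⟨s, rfl⟩ := exists_comp₁_eq h₁ h₂ h₃ hE i j hi hj γ₁ hγ₁
  exact ⟨s, (corresponds_comp₁₂ V s).left_injective h⟩

theorem exists_comp₃_eq (h₁ : S₁.ExactSequence) (h₂ : S₂.ExactSequence) (h₃ : S₃.ExactSequence)
    (hE : RoughEquiv.Compatible E₁₂ E₂₃ E₃₁) {V : Opens O} (i : E₃₁.ι) (j : E₂₃.ι) (k : E₁₂.ι)
    (hi : V ≤ E₃₁.U i) (hj : V ≤ E₂₃.U j) (hk : V ≤ E₁₂.U k) (γ : S₃.LoopSection V)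
    (hγ : S₃.IsLoopCell V (LoopSection.cls γ)) : ∃ s, comp₃ E₁₂ E₂₃ E₃₁ V s = γ := by
  obtain ⟨γ₂, hγ₂, h⟩ := E₂₃.exists_corresponds j hj hγ
  obtain ⟨s, rfl⟩ := exists_comp₂_eq h₁ h₂ h₃ hE i j k hi hj hk γ₂ hγ₂
  exact ⟨s, (corresponds_comp₂₃ V s).left_injective h⟩

/-- The sum of three Chern classes around a triangle of compatible rough equivalences vanishes. -/
theorem chernClass_add_add_eq_zero (h₁ : S₁.ExactSequence) (h₂ : S₂.ExactSequence)
    (h₃ : S₃.ExactSequence) (hE : RoughEquiv.Compatible E₁₂ E₂₃ E₃₁)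
    {μ₁₂ μ₂₃ μ₃₁ : Cech.H2 (commonSheaf E₁₂ E₂₃ E₃₁)}
    (hμ₁₂ : E₁₂.IsChernClass (comp₂ E₁₂ E₂₃ E₃₁) μ₁₂)
    (hμ₂₃ : E₂₃.IsChernClass (comp₃ E₁₂ E₂₃ E₃₁) μ₂₃)
    (hμ₃₁ : E₃₁.IsChernClass (comp₁ E₁₂ E₂₃ E₃₁) μ₃₁) : μ₁₂ + μ₂₃ + μ₃₁ = 0 := by
  obtain ⟨𝒱₁, τ₁, hτ₁, ψ₁, r₁, hr₁, rfl⟩ := hμ₁₂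
  obtain ⟨𝒱₂, τ₂, hτ₂, ψ₂, r₂, hr₂, rfl⟩ := hμ₂₃
  obtain ⟨𝒱₃, τ₃, hτ₃, ψ₃, r₃, hr₃, rfl⟩ := hμ₃₁
  -- Compatibility and exactness join the local composite at `x` to the identity. Only single
  -- members need this, so shrinking around `x` suffices.
  have hlift : ∀ x, ∃ V : Opens O, x ∈ V ∧ V ≤ E₃₁.U (τ₃ x) ⊓ E₂₃.U (τ₂ x) ⊓ E₁₂.U (τ₁ x) ∧
      Nonempty (S₁.Lift V
        (((E₃₁.Φ (τ₃ x)).trans (E₂₃.Φ (τ₂ x))).trans (E₁₂.Φ (τ₁ x)))) := fun x =>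
    h₁.lifts _ _ (hE (τ₃ x) (τ₂ x) (τ₁ x)) x
      ⟨⟨hτ₃ x (𝒱₃.mem x), hτ₂ x (𝒱₂.mem x)⟩, hτ₁ x (𝒱₁.mem x)⟩
  choose V hxV hVU hV using hlift
  let 𝒲 : PointedCover O := ⟨fun x => V x ⊓ (𝒱₁.V x ⊓ (𝒱₂.V x ⊓ 𝒱₃.V x)),
    fun x => ⟨hxV x, 𝒱₁.mem x, 𝒱₂.mem x, 𝒱₃.mem x⟩⟩
  have hWV : ∀ x, 𝒲.V x ≤ V x := fun x => inf_le_left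
  have hW₁ : 𝒱₁ ≤ 𝒲 := fun x => inf_le_right.trans inf_le_left
  have hW₂ : 𝒱₂ ≤ 𝒲 := fun x => inf_le_right.trans (inf_le_right.trans inf_le_left)
  have hW₃ : 𝒱₃ ≤ 𝒲 := fun x => inf_le_right.trans (inf_le_right.trans inf_le_right)
  let s₁ := Cech.resZ2 _ hW₁ r₁
  let s₂ := Cech.resZ2 _ hW₂ r₂
  let s₃ := Cech.resZ2 _ hW₃ r₃
  have hc₁ := (E₁₂.isCocycle_liftCell 𝒱₁.V τ₁ hτ₁ ψ₁ _ _
    (fun x y z => isLoopCell_comp₁ _ (r₁.1 x y z))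
    (fun x y z => corresponds_comp₁₂ _ (r₁.1 x y z)) hr₁).mono hW₁
  have hc₂ := (E₂₃.isCocycle_liftCell 𝒱₂.V τ₂ hτ₂ ψ₂ _ _
    (fun x y z => isLoopCell_comp₂ _ (r₂.1 x y z))
    (fun x y z => corresponds_comp₂₃ _ (r₂.1 x y z)) hr₂).mono hW₂
  have hc₃ := (E₃₁.isCocycle_liftCell 𝒱₃.V τ₃ hτ₃ ψ₃ _ _
    (fun x y z => isLoopCell_comp₃ _ (r₃.1 x y z))
    (fun x y z => corresponds_comp₃₁ _ (r₃.1 x y z)) hr₃).mono hW₃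
  have hc₃₂ := hc₃.comp hc₂
    (ρ' := fun x y z => LoopSection.cls (comp₂ E₁₂ E₂₃ E₃₁ _ (s₃.1 x y z)))
    (fun x y z => isLoopCell_comp₂ _ _)
    (fun x y z q hq => E₂₃.corresponds_iff.1 (corresponds_comp₂₃ _ (s₃.1 x y z)) (τ₂ x) q hq
      (hτ₂ x (hW₂ x hq.1.1)))
  -- The composites `S₁ → S₃ → S₂ → S₁` have as defect the product of the three Chern cocycles, all
  -- read in `S₁`.
  have hc := hc₃₂.comp hc₁
    (ρ' := fun x y z p hp => LoopSection.cls (comp₁ E₁₂ E₂₃ E₃₁ _ (s₃.1 x y z)) p hp ⬝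
      LoopSection.cls (comp₁ E₁₂ E₂₃ E₃₁ _ (s₂.1 x y z)) p hp)
    (fun x y z => (isLoopCell_comp₁ _ _).trans (isLoopCell_comp₁ _ _))
    (fun x y z q hq => by
      have hq₁ := hτ₁ x (hW₁ x hq.1.1)
      refine (IsLeafMap.cls_trans _ hq.1.1 hq.1.1 _ _).trans ?_
      exact congrArg₂ Path.Homotopic.Quotient.trans
        (E₁₂.corresponds_iff.1 (corresponds_comp₁₂ _ (s₃.1 x y z)) (τ₁ x) q hq hq₁)
        (E₁₂.corresponds_iff.1 (corresponds_comp₁₂ _ (s₂.1 x y z)) (τ₁ x) q hq hq₁))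
  obtain ⟨t, ht, hts⟩ := hc.trivialize (fun x p hp => (hV x).some.cls p (hWV x hp))
    (fun x => (continuousClasses_iff.1 (hV x).some.continuous_cls).mono (hWV x))
  -- The trivializing loop families become sections of the common sheaf: a one-cochain bounding the
  -- sum of the cocycles.
  choose b hb using fun x y => exists_comp₁_eq h₁ h₂ h₃ hE (τ₃ x) (τ₂ x)
    (V := 𝒲.V x ⊓ 𝒲.V y) (inf_le_left.trans ((hW₃ x).trans (hτ₃ x)))
    (inf_le_left.trans ((hW₂ x).trans (hτ₂ x))) (ht x y).toSection (ht x y)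
  rw [← Cech.H2.mk_resZ2 _ hW₁, ← Cech.H2.mk_resZ2 _ hW₂, ← Cech.H2.mk_resZ2 _ hW₃,
    ← Cech.H2.mk_add, ← Cech.H2.mk_add]
  refine Cech.H2.mk_eq_zero _ _ b ?_
  funext x y z
  suffices h : Cech.res _ (Cech.le_xy _ _ _) (b x y) + Cech.res _ (Cech.le_yz _ _ _) (b y z) =
      (s₃.1 x y z + s₂.1 x y z + s₁.1 x y z) +
        Cech.res _ (Cech.le_xz (𝒲.V x) (𝒲.V y) (𝒲.V z)) (b x z) by
    change Cech.res _ _ (b y z) - Cech.res _ _ (b x z) + Cech.res _ _ (b x y) =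
      s₁.1 x y z + s₂.1 x y z + s₃.1 x y z
    rw [sub_add_eq_add_sub, add_comm (Cech.res _ _ (b y z)), h]
    abel
  apply comp₁_injective
  refine LoopSection.ext_cls fun p hp => ?_
  have key := hts x y z p hp
  have hbc : ∀ x y p (hp : S₁.π p ∈ 𝒲.V x ⊓ 𝒲.V y),
      t x y p hp = LoopSection.cls (comp₁ E₁₂ E₂₃ E₃₁ _ (b x y)) p hp := fun x y p hp => by
    rw [hb, IsLoopCell.cls_toSection]
  have add : ∀ (V : Opens O) (s t : (commonSheaf E₁₂ E₂₃ E₃₁).obj (op V)),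
      comp₁ E₁₂ E₂₃ E₃₁ V (s + t) = comp₁ E₁₂ E₂₃ E₃₁ V s * comp₁ E₁₂ E₂₃ E₃₁ V t :=
    fun _ _ _ => rfl
  rw [add, add, add, add, LoopSection.cls_mul, LoopSection.cls_mul, LoopSection.cls_mul,
    LoopSection.cls_mul]
  exact (congrArg₂ Path.Homotopic.Quotient.trans (hbc x y p hp.1) (hbc y z p _)).symm.trans
    (key.trans (congrArg (Path.Homotopic.Quotient.trans _) (hbc x z p _)))

end Three
end

/-! ### Existence, uniqueness and the sum formula -/

theorem mainTheorem9 {O : Type} [TopologicalSpace O] [T2Space O] [ParacompactSpace O]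
    (S₁ S₂ S₃ : IntegrableSystem O)
    (h₁ : S₁.ExactSequence) (h₂ : S₂.ExactSequence) (h₃ : S₃.ExactSequence)
    (E₁₂ : RoughEquiv S₂ S₁) (E₂₃ : RoughEquiv S₃ S₂) (E₃₁ : RoughEquiv S₁ S₃)
    (hE : RoughEquiv.Compatible E₁₂ E₂₃ E₃₁) :
    (∃! μ₁₂ : Cech.H2 (commonSheaf E₁₂ E₂₃ E₃₁), E₁₂.IsChernClass (comp₂ E₁₂ E₂₃ E₃₁) μ₁₂) ∧
    (∃! μ₂₃ : Cech.H2 (commonSheaf E₁₂ E₂₃ E₃₁), E₂₃.IsChernClass (comp₃ E₁₂ E₂₃ E₃₁) μ₂₃) ∧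
    (∃! μ₃₁ : Cech.H2 (commonSheaf E₁₂ E₂₃ E₃₁), E₃₁.IsChernClass (comp₁ E₁₂ E₂₃ E₃₁) μ₃₁) ∧
    ∀ μ₁₂ μ₂₃ μ₃₁ : Cech.H2 (commonSheaf E₁₂ E₂₃ E₃₁),
      E₁₂.IsChernClass (comp₂ E₁₂ E₂₃ E₃₁) μ₁₂ →
      E₂₃.IsChernClass (comp₃ E₁₂ E₂₃ E₃₁) μ₂₃ →
      E₃₁.IsChernClass (comp₁ E₁₂ E₂₃ E₃₁) μ₃₁ →
      μ₁₂ + μ₂₃ + μ₃₁ = 0 := by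
  choose i hi using E₃₁.cover
  choose j hj using E₂₃.cover
  choose k hk using E₁₂.cover
  -- Over subsets of the members of `𝒰` all three equivalences are given by single homeomorphisms,
  -- so each loop family extends to a section of the common sheaf.
  let 𝒰 : PointedCover O := ⟨fun x => E₃₁.U (i x) ⊓ (E₂₃.U (j x) ⊓ E₁₂.U (k x)),
    fun x => ⟨hi x, hj x, hk x⟩⟩
  have hUi : ∀ x, 𝒰.V x ≤ E₃₁.U (i x) := fun x => inf_le_left
  have hUj : ∀ x, 𝒰.V x ≤ E₂₃.U (j x) := fun x => inf_le_right.trans inf_le_left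
  have hUk : ∀ x, 𝒰.V x ≤ E₁₂.U (k x) := fun x => inf_le_right.trans inf_le_right
  obtain ⟨c₁₂, hc₁₂⟩ := E₁₂.exists_isChernClass h₂ (comp₂ E₁₂ E₂₃ E₃₁) (comp₁ E₁₂ E₂₃ E₃₁) 𝒰
    (fun x V hV γ hγ => exists_comp₂_eq h₁ h₂ h₃ hE (i x) (j x) (k x) (hV.trans (hUi x))
      (hV.trans (hUj x)) (hV.trans (hUk x)) γ hγ)
    corresponds_comp₁₂ isLoopCell_comp₁ comp₁_injective (fun _ _ _ => rfl) (fun _ _ _ _ => rfl)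
  obtain ⟨c₂₃, hc₂₃⟩ := E₂₃.exists_isChernClass h₃ (comp₃ E₁₂ E₂₃ E₃₁) (comp₂ E₁₂ E₂₃ E₃₁) 𝒰
    (fun x V hV γ hγ => exists_comp₃_eq h₁ h₂ h₃ hE (i x) (j x) (k x) (hV.trans (hUi x))
      (hV.trans (hUj x)) (hV.trans (hUk x)) γ hγ)
    corresponds_comp₂₃ isLoopCell_comp₂ comp₂_injective (fun _ _ _ => rfl) (fun _ _ _ _ => rfl)
  obtain ⟨c₃₁, hc₃₁⟩ := E₃₁.exists_isChernClass h₁ (comp₁ E₁₂ E₂₃ E₃₁) (comp₃ E₁₂ E₂₃ E₃₁) 𝒰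
    (fun x V hV γ hγ => exists_comp₁_eq h₁ h₂ h₃ hE (i x) (j x) (hV.trans (hUi x))
      (hV.trans (hUj x)) γ hγ)
    corresponds_comp₃₁ isLoopCell_comp₃ comp₃_injective (fun _ _ _ => rfl) (fun _ _ _ _ => rfl)
  have sum : ∀ μ₁₂ μ₂₃ μ₃₁ : Cech.H2 (commonSheaf E₁₂ E₂₃ E₃₁),
      E₁₂.IsChernClass (comp₂ E₁₂ E₂₃ E₃₁) μ₁₂ → E₂₃.IsChernClass (comp₃ E₁₂ E₂₃ E₃₁) μ₂₃ →
      E₃₁.IsChernClass (comp₁ E₁₂ E₂₃ E₃₁) μ₃₁ → μ₁₂ + μ₂₃ + μ₃₁ = 0 :=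
    fun _ _ _ => chernClass_add_add_eq_zero h₁ h₂ h₃ hE
  -- Two candidates for one class, completed by the same other two, both give sum zero and hence
  -- agree.
  refine ⟨⟨c₁₂, hc₁₂, fun c hc => ?_⟩, ⟨c₂₃, hc₂₃, fun c hc => ?_⟩, ⟨c₃₁, hc₃₁, fun c hc => ?_⟩,
    sum⟩
  · exact add_right_cancel (add_right_cancel
      ((sum c c₂₃ c₃₁ hc hc₂₃ hc₃₁).trans (sum c₁₂ c₂₃ c₃₁ hc₁₂ hc₂₃ hc₃₁).symm))
  · exact add_left_cancel (add_right_cancel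
      ((sum c₁₂ c c₃₁ hc₁₂ hc hc₃₁).trans (sum c₁₂ c₂₃ c₃₁ hc₁₂ hc₂₃ hc₃₁).symm))
  · exact add_left_cancel
      ((sum c₁₂ c₂₃ c hc₁₂ hc₂₃ hc).trans (sum c₁₂ c₂₃ c₃₁ hc₁₂ hc₂₃ hc₃₁).symm)
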